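/- Let $\mathbb S^1=\mathbb R/\mathbb Z$ and let $l_1,l_2,l_3\ge 0$ with $l_1+l_2+l_3=1$. Let $F_0:\mathbb S^1\to\mathbb S^1$ be the involution that reverses each of the three open arcs $(0,l_1)$, $(l_1,l_1+l_2)$, $(l_1+l_2,1)$, i.e. $F_0(t)=a+b-t$ for $t$ in the arc $(a,b)$, and fixes their endpoints. For $\tau\in\mathbb S^1$ let $F_\tau^{l_1,l_2,l_3}=R_\tau\circ F_0$, where $R_\tau(p)=p+\tau$; these maps form the family $\mathrm{CET}^3$. Call a map $F:\mathbb S^1\to\mathbb S^1$ minimal if for every $p\in\mathbb S^1$ the orbit $\{F^n(p): n\ge 0\}$ is dense in $\mathbb S^1$. The Rauzy subtractive algorithm acts on triples $(x_1,x_2,x_3)$ with $x_1+x_2+x_3=1$ as follows: if $x_j>\tfrac12$ for some $j$, replace $x_j$ by $2x_j-1$, keep the other two coordinates, and divide the resulting triple by its sum (which equals the old $x_j$); otherwise it cannot be applied. Let $\mathcal R$ be the set of all $(x_1,x_2,x_3)$ with $x_1,x_2,x_3>0$, $x_1+x_2+x_3=1$, to which this algorithm (with the strict inequality $x_j>\tfrac12$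 for some $j$ at each step) can be applied infinitely many times; $\mathcal R$ is the Rauzy gasket (without its boundary). **Theorem.** The map $F_\tau^{l_1,l_2,l_3}$ is minimal if and only if $\tau=\tfrac12$ in $\mathbb R/\mathbb Z$ and $(1-2l_1,\,1-2l_2,\,1-2l_3)\in\mathcal R$. -/

import Mathlib

noncomputable section

open Classical in
/-- The involution of the circle `ℝ/ℤ` that reverses the open arc `(a, b)`, i.e. `t ↦ a + b - t`
there, and is the identity off that arc (used for `0 ≤ a ≤ b ≤ 1`). -/
def arcFlip (a b : ℝ) (p : UnitAddCircle) : UnitAddCircle :=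
  if ∃ t ∈ Set.Ioo a b, (t : UnitAddCircle) = p then ((a + b : ℝ) : UnitAddCircle) - p else p

/-- The global involution `F₀`: the composition of the (commuting) flips of the three arcs
`(0, l₁)`, `(l₁, l₁ + l₂)`, `(l₁ + l₂, l₁ + l₂ + l₃)`. The common endpoints are fixed. -/
def cetInvolution (l : Fin 3 → ℝ) : UnitAddCircle → UnitAddCircle :=
  arcFlip (l 0 + l 1) (l 0 + l 1 + l 2) ∘ arcFlip (l 0) (l 0 + l 1) ∘ arcFlip 0 (l 0)

/-- The map `F_τ^{l₁,l₂,l₃} = R_τ ∘ F₀`, with `R_τ` the rotation by `τ`. -/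
def cetMap (l : Fin 3 → ℝ) (τ : UnitAddCircle) (p : UnitAddCircle) : UnitAddCircle :=
  cetInvolution l p + τ

/-- A (not necessarily continuous) self-map is minimal if the forward orbit of every point is
dense. -/
def IsMinimalMap {X : Type*} [TopologicalSpace X] (F : X → X) : Prop :=
  ∀ p : X, Dense (Set.range fun n : ℕ => F^[n] p)

/-- One step of the Rauzy subtractive algorithm with index `j` in play: `x_j` is replaced by
`2 x_j - 1`, and the triple is divided by its new sum, which is `x_j` when `∑ x_i = 1`. -/
def rauzyStep (j : Fin 3) (x : Fin 3 → ℝ) : Fin 3 → ℝ :=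
  fun i => (if i = j then 2 * x j - 1 else x i) / x j

/-- The Rauzy gasket without its boundary: the triples of the open simplex to which the Rauzy
subtractive algorithm can be applied infinitely often, with some coordinate strictly larger than
`1/2` at each step. -/
def rauzyGasket : Set (Fin 3 → ℝ) :=
  {x | (∀ i, 0 < x i) ∧ ∑ i, x i = 1 ∧
    ∃ y : ℕ → Fin 3 → ℝ, y 0 = x ∧
      ∀ n, ∃ j, 1 / 2 < y n j ∧ y (n + 1) = rauzyStep j (y n)}

end

open Filter Topology

/-! The engine is an induction of Rauzy type. Lengths are not normalized. If no arc is longer than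
`τ` or than the total minus `τ`, and the middle arc `b` is a shortest one, then, apart from
borderline parameters, inducing on `[b - a, c)` gives a map of the same family with lengths `a - b,
b, c - b` and rotation `τ - b` (`renorm_step`). In the coordinates `1 - 2 * l i / total` this is the
Rauzy subtractive step (`inexhaustible_iff`).

Minimality excludes periodic points. A map without periodic points admits the induction, and the
induced map again has none (`exists_subtractArc`), so the process never stops. The total length then
tends to zero (`tendsto_sum_of_subtractArc`), whereas the total minus `2 * τ` never changes and is
bounded in absolute value by the total. Hence it vanishes, `τ` is half of the circle, and the
lengths are `Inexhaustible`.

Conversely, let `τ` be half of the circle and the lengths inexhaustible. Induction shortens any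
orbit segment joining two endpoints of arcs, so none exists (`not_hasConnection`). It preserves the
width of an interval of regular points while the total shrinks to zero, so no such interval exists
(`not_hasRegularInterval`). These two facts force minimality of a bijective piecewise reflection
(`IsLocalReflection.isMinimalMap`): otherwise a limit set of some orbit has a gap, whose end has a
regular forward or backward orbit; the gap is carried along that orbit, eventually without
shrinking, and the circle has no room for infinitely many copies. -/

/-- The exchange of three flipped arcs, read on the fundamental domain `[-a, b + c)` of the circle
of length `a + b + c`: the arcs `(-a, 0)`, `(0, b)`, `(b, b + c)` are reversed, their endpoints are
fixed, and the result is rotated by `τ`. -/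
noncomputable def flipMap (a b c τ x : ℝ) : ℝ :=
  let y := (if x = -a ∨ x = 0 ∨ x = b then x else if x < 0 then -a - x else
    if x < b then b - x else 2 * b + c - x) + τ
  if y < b + c then y else y - (a + b + c)

/-- The endpoints of the three arcs. -/
def breaks (a b : ℝ) : Set ℝ := {-a, 0, b}

theorem mem_breaks {a b x : ℝ} : x ∈ breaks a b ↔ x = -a ∨ x = 0 ∨ x = b := Iff.rfl

/-! ### Values of the flipped exchange on each arc. -/

section Evaluation

variable {a b c τ x : ℝ}

theorem flipMap_break (h : x = -a ∨ x = 0 ∨ x = b) (hy : x + τ < b + c) :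
    flipMap a b c τ x = x + τ := by
  simp only [flipMap, if_pos h, if_pos hy]

theorem flipMap_break_wrap (h : x = -a ∨ x = 0 ∨ x = b) (hy : b + c ≤ x + τ) :
    flipMap a b c τ x = x + τ - (a + b + c) := by
  simp only [flipMap, if_pos h, if_neg hy.not_gt]

theorem flipMap_left (hb : 0 ≤ b) (h₁ : -a < x) (h₂ : x < 0) (hy : -a - x + τ < b + c) :
    flipMap a b c τ x = -a - x + τ := by
  have h : ¬ (x = -a ∨ x = 0 ∨ x = b) := by
    rintro (h | h | h) <;> linarith
  simp only [flipMap, if_neg h, if_pos h₂, if_pos hy]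

theorem flipMap_mid (ha : 0 ≤ a) (h₁ : 0 < x) (h₂ : x < b) (hy : b - x + τ < b + c) :
    flipMap a b c τ x = b - x + τ := by
  have h : ¬ (x = -a ∨ x = 0 ∨ x = b) := by
    rintro (h | h | h) <;> linarith
  simp only [flipMap, if_neg h, if_neg h₁.not_gt, if_pos h₂, if_pos hy]

theorem flipMap_mid_wrap (ha : 0 ≤ a) (h₁ : 0 < x) (h₂ : x < b) (hy : b + c ≤ b - x + τ) :
    flipMap a b c τ x = b - x + τ - (a + b + c) := by
  have h : ¬ (x = -a ∨ x = 0 ∨ x = b) := by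
    rintro (h | h | h) <;> linarith
  simp only [flipMap, if_neg h, if_neg h₁.not_gt, if_pos h₂, if_neg hy.not_gt]

theorem flipMap_right (ha : 0 ≤ a) (hb : 0 ≤ b) (h₁ : b < x) (hy : 2 * b + c - x + τ < b + c) :
    flipMap a b c τ x = 2 * b + c - x + τ := by
  have h : ¬ (x = -a ∨ x = 0 ∨ x = b) := by
    rintro (h | h | h) <;> linarith
  have h₃ : ¬ x < 0 := by linarith
  simp only [flipMap, if_neg h, if_neg h₃, if_neg h₁.not_gt, if_pos hy]

theorem flipMap_right_wrap (ha : 0 ≤ a) (hb : 0 ≤ b) (h₁ : b < x)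
    (hy : b + c ≤ 2 * b + c - x + τ) :
    flipMap a b c τ x = 2 * b + c - x + τ - (a + b + c) := by
  have h : ¬ (x = -a ∨ x = 0 ∨ x = b) := by
    rintro (h | h | h) <;> linarith
  have h₃ : ¬ x < 0 := by linarith
  simp only [flipMap, if_neg h, if_neg h₃, if_neg h₁.not_gt, if_neg hy.not_gt]

end Evaluation

theorem flipMap_mem {a b c τ x : ℝ} (ha : 0 ≤ a) (hb : 0 ≤ b) (hc : 0 ≤ c) (hτ : 0 ≤ τ)
    (hτs : τ ≤ a + b + c) (hx : x ∈ Set.Ico (-a) (b + c)) :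
    flipMap a b c τ x ∈ Set.Ico (-a) (b + c) := by
  obtain ⟨h₁, h₂⟩ := hx
  simp only [flipMap, Set.mem_Ico]
  split_ifs with h h' h'' h''' <;> (try push Not at *) <;> constructor <;> grind

theorem iterate_mem {α : Type*} {f : α → α} {D : Set α} (hf : ∀ x ∈ D, f x ∈ D) {x : α}
    (hx : x ∈ D) (n : ℕ) : f^[n] x ∈ D :=
  Set.MapsTo.iterate (fun _ h => hf _ h) n hx

/-- The map has a periodic point in its fundamental domain. -/
def HasPeriodic (a b c τ : ℝ) : Prop :=
  ∃ x ∈ Set.Ico (-a) (b + c), x ∈ Function.periodicPts (flipMap a b c τ)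

/-- A forward orbit joins two endpoints of arcs in `n` steps. -/
def HasConnection (a b c τ : ℝ) (n : ℕ) : Prop :=
  ∃ x ∈ breaks a b, (flipMap a b c τ)^[n] x ∈ breaks a b

/-- The points whose forward orbit avoids all endpoints of arcs. -/
def regularSet (a b c τ : ℝ) : Set ℝ :=
  {x | x ∈ Set.Ico (-a) (b + c) ∧ ∀ n, (flipMap a b c τ)^[n] x ∉ breaks a b}

/-- An open interval of length `w` consists of points with regular forward orbits. -/
def HasRegularInterval (a b c τ w : ℝ) : Prop :=
  ∃ x, Set.Ioo x (x + w) ⊆ regularSet a b c τ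

/-! ### Cyclic relabelling: any arc may be put in the middle. -/

section Relabelling

/-- The coordinate change for the cyclic relabelling `(a, b, c) ↦ (b, c, a)` of the arcs. -/
noncomputable def relabel (a b c x : ℝ) : ℝ := if x < 0 then x + (a + c) else x - b

variable {a b c τ x : ℝ}

theorem relabel_mem (hx : x ∈ Set.Ico (-a) (b + c)) (hc : 0 ≤ c) (hb : 0 ≤ b) (ha : 0 ≤ a) :
    relabel a b c x ∈ Set.Ico (-b) (c + a) := by
  obtain ⟨h₁, h₂⟩ := hx
  unfold relabel
  split_ifs <;> constructor <;> linarith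

theorem relabel_flipMap (ha : 0 ≤ a) (hb : 0 ≤ b) (hc : 0 ≤ c) (hτ : 0 ≤ τ)
    (hτs : τ ≤ a + b + c) (hx : x ∈ Set.Ico (-a) (b + c)) :
    relabel a b c (flipMap a b c τ x) = flipMap b c a τ (relabel a b c x) := by
  obtain ⟨h₁, h₂⟩ := hx
  simp only [flipMap, relabel]
  grind

theorem relabel_iterate (ha : 0 ≤ a) (hb : 0 ≤ b) (hc : 0 ≤ c) (hτ : 0 ≤ τ)
    (hτs : τ ≤ a + b + c) (hx : x ∈ Set.Ico (-a) (b + c)) (n : ℕ) :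
    relabel a b c ((flipMap a b c τ)^[n] x) = (flipMap b c a τ)^[n] (relabel a b c x) := by
  induction n with
  | zero => rfl
  | succ n ih =>
    rw [Function.iterate_succ_apply', Function.iterate_succ_apply', ← ih,
      relabel_flipMap ha hb hc hτ hτs
        (iterate_mem (fun _ h => flipMap_mem ha hb hc hτ hτs h) hx n)]

/-- Positivity of `c` keeps the endpoint `b` inside the half-open domain `[-a, b + c)`. -/
theorem relabel_mem_breaks (ha : 0 ≤ a) (hb : 0 ≤ b) (hc : 0 < c)
    (hx : x ∈ Set.Ico (-a) (b + c)) :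
    relabel a b c x ∈ breaks b c ↔ x ∈ breaks a b := by
  obtain ⟨h₁, h₂⟩ := hx
  simp only [mem_breaks, relabel]
  grind

theorem HasPeriodic.relabel (ha : 0 ≤ a) (hb : 0 ≤ b) (hc : 0 ≤ c) (hτ : 0 ≤ τ)
    (hτs : τ ≤ a + b + c) (h : HasPeriodic a b c τ) : HasPeriodic b c a τ := by
  obtain ⟨x, hx, n, hn, hp⟩ := h
  refine ⟨_, relabel_mem hx hc hb ha, n, hn, ?_⟩
  rw [Function.IsPeriodicPt, Function.IsFixedPt, ← relabel_iterate ha hb hc hτ hτs hx, hp]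

theorem breaks_subset (ha : 0 ≤ a) (hb : 0 ≤ b) (hc : 0 < c) :
    breaks a b ⊆ Set.Ico (-a) (b + c) := by
  intro x hx
  rcases mem_breaks.1 hx with h | h | h <;> constructor <;> linarith

theorem HasConnection.relabel (ha : 0 ≤ a) (hb : 0 ≤ b) (hc : 0 < c) (hτ : 0 ≤ τ)
    (hτs : τ ≤ a + b + c) {n : ℕ} (h : HasConnection a b c τ n) : HasConnection b c a τ n := by
  obtain ⟨x, hx, hn⟩ := h
  have hD := breaks_subset ha hb hc hx
  refine ⟨_, (relabel_mem_breaks ha hb hc hD).2 hx, ?_⟩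
  rw [← relabel_iterate ha hb hc.le hτ hτs hD]
  exact (relabel_mem_breaks ha hb hc
    (iterate_mem (fun _ h => flipMap_mem ha hb hc.le hτ hτs h) hD n)).2 hn

theorem relabel_mem_regularSet (ha : 0 ≤ a) (hb : 0 ≤ b) (hc : 0 < c) (hτ : 0 ≤ τ)
    (hτs : τ ≤ a + b + c) (h : x ∈ regularSet a b c τ) :
    relabel a b c x ∈ regularSet b c a τ := by
  refine ⟨relabel_mem h.1 hc.le hb ha, fun n hn => h.2 n ?_⟩
  rw [← relabel_iterate ha hb hc.le hτ hτs h.1] at hn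
  exact (relabel_mem_breaks ha hb hc
    (iterate_mem (fun _ h => flipMap_mem ha hb hc.le hτ hτs h) h.1 n)).1 hn

theorem HasRegularInterval.relabel (ha : 0 ≤ a) (hb : 0 ≤ b) (hc : 0 < c) (hτ : 0 ≤ τ)
    (hτs : τ ≤ a + b + c) {w : ℝ} (h : HasRegularInterval a b c τ w) :
    HasRegularInterval b c a τ w := by
  obtain ⟨x, hx⟩ := h
  by_cases h0 : x < 0
  -- The coordinate change jumps only at `0`, an endpoint of arcs, which a regular interval cannot
  -- contain.
  · have hle : ∀ z ∈ Set.Ioo x (x + w), z < 0 := by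
      intro z hz
      by_contra hz0
      exact (hx (show (0 : ℝ) ∈ _ from ⟨h0, by linarith [hz.2, hz.1]⟩)).2 0 (Or.inr (Or.inl rfl))
    refine ⟨x + (a + c), fun y hy => ?_⟩
    have hz : y - (a + c) ∈ Set.Ioo x (x + w) := ⟨by linarith [hy.1], by linarith [hy.2]⟩
    have := relabel_mem_regularSet ha hb hc hτ hτs (hx hz)
    rwa [_root_.relabel, if_pos (hle _ hz), sub_add_cancel] at this
  · refine ⟨x - b, fun y hy => ?_⟩
    have hz : y + b ∈ Set.Ioo x (x + w) := ⟨by linarith [hy.1], by linarith [hy.2]⟩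
    have := relabel_mem_regularSet ha hb hc hτ hτs (hx hz)
    rwa [_root_.relabel, if_neg (by linarith [hz.1]), add_sub_cancel_right] at this

end Relabelling

/-! ### Inducing on the domain shortened by the middle arc on both sides. -/

section Renormalization

/-- The inclusion of the fundamental domain `[b - a, c)` of the renormalized map; its left end
stands for the left end `-a` of the original one. -/
noncomputable def renormIncl (a b x : ℝ) : ℝ := if x = b - a then -a else x

/-- The parameters for which the middle arc can be subtracted from the two others. -/
structure Renormalizable (a b c τ : ℝ) : Prop where
  pos : 0 < b
  le_left : b ≤ a
  le_right : b ≤ c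
  left_le : a ≤ τ
  right_le : c ≤ τ
  le_left_add : τ ≤ a + b
  le_add_right : τ ≤ b + c
  mid_lt : b < τ
  lt_outer : τ < a + c

variable {a b c τ x : ℝ}

/-- On the outer arcs the two formulas agree: the shifts of lengths and rotation cancel, so one step
suffices. -/
theorem renorm_outer (h : Renormalizable a b c τ) (hx : x ∈ Set.Ico (b - a) c)
    (hout : x < 0 ∨ b < x) (hne : x ≠ b - a) :
    flipMap a b c τ x = renormIncl a b (flipMap (a - b) b (c - b) (τ - b) x) := by
  obtain ⟨hb, hba, hbc, haτ, hcτ, hτa, hτc, hbτ, hτs⟩ := h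
  obtain ⟨h₁, h₂⟩ := hx
  have h₃ := lt_of_le_of_ne h₁ hne.symm
  rcases hout with h | h
  · rw [flipMap_left hb.le (by linarith) h (by linarith),
      flipMap_left hb.le (by linarith) h (by linarith), renormIncl, if_neg (by linarith)]
    ring
  · rw [flipMap_right_wrap (by linarith) hb.le h (by linarith),
      flipMap_right_wrap (by linarith) hb.le h (by linarith), renormIncl, if_neg (by linarith)]
    ring

/-- A point of the middle arc leaves the small domain on one side, crosses to the other side and
comes back: for `x > τ - c` the orbit is `x, τ + b - x, x - a, τ - x`, and otherwise the two
excursions occur in the opposite order. The excluded point `τ - c` is sent to the end `-a` at once.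
-/
theorem renorm_inner (h : Renormalizable a b c τ) (hx : 0 < x) (hxb : x < b)
    (hne : x ≠ τ - c) :
    (flipMap a b c τ x ∉ breaks a b ∧ flipMap a b c τ (flipMap a b c τ x) ∉ breaks a b) ∧
    flipMap a b c τ (flipMap a b c τ (flipMap a b c τ x)) =
      renormIncl a b (flipMap (a - b) b (c - b) (τ - b) x) := by
  obtain ⟨hb, hba, hbc, haτ, hcτ, hτa, hτc, hbτ, hτs⟩ := h
  have ha : 0 ≤ a := by linarith
  rcases lt_or_gt_of_ne hne with h | h
  · rw [flipMap_mid_wrap ha hx hxb (by linarith),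
      flipMap_left hb.le (by linarith) (by linarith) (by linarith),
      flipMap_right_wrap ha hb.le (by linarith) (by linarith),
      flipMap_mid_wrap (by linarith) hx hxb (by linarith), renormIncl, if_neg (by linarith)]
    simp only [mem_breaks]
    grind
  · rw [flipMap_mid ha hx hxb (by linarith),
      flipMap_right_wrap ha hb.le (by linarith) (by linarith),
      flipMap_left hb.le (by linarith) (by linarith) (by linarith),
      flipMap_mid (by linarith) hx hxb (by linarith), renormIncl, if_neg (by linarith)]
    simp only [mem_breaks]
    grind

theorem renorm_cut (h : Renormalizable a b c τ) (hx : 0 < x) (hxb : x < b) (hu : x = τ - c) :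
    flipMap a b c τ x = renormIncl a b (flipMap (a - b) b (c - b) (τ - b) x) := by
  obtain ⟨hb, hba, hbc, haτ, hcτ, hτa, hτc, hbτ, hτs⟩ := h
  rw [flipMap_mid_wrap (by linarith) hx hxb (by linarith),
    flipMap_mid_wrap (by linarith) hx hxb (by linarith), renormIncl, if_pos (by linarith)]
  linarith

theorem renorm_zero (h : Renormalizable a b c τ) (hba' : b < a) (hτ : τ < b + c) :
    (flipMap a b c τ 0 ∉ breaks a b ∧ flipMap a b c τ (flipMap a b c τ 0) ∉ breaks a b) ∧
    flipMap a b c τ (flipMap a b c τ (flipMap a b c τ 0)) =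
      renormIncl a b (flipMap (a - b) b (c - b) (τ - b) 0) := by
  obtain ⟨hb, hba, hbc, haτ, hcτ, hτa, hτc, hbτ, hτs⟩ := h
  have ha : 0 ≤ a := by linarith
  rw [flipMap_break (by simp) (by linarith),
    flipMap_right_wrap ha hb.le (by linarith) (by linarith),
    flipMap_left hb.le (by linarith) (by linarith) (by linarith),
    flipMap_break (by simp) (by linarith), renormIncl, if_neg (by linarith)]
  simp only [mem_breaks]
  grind

theorem renorm_zero_cut (hτ : τ = b + c) :
    flipMap a b c τ 0 = renormIncl a b (flipMap (a - b) b (c - b) (τ - b) 0) := by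
  rw [flipMap_break_wrap (by simp) (by linarith), flipMap_break_wrap (by simp) (by linarith),
    renormIncl, if_pos (by linarith)]
  linarith

theorem renorm_right (h : Renormalizable a b c τ) (hbc' : b < c) (hτ : c < τ) :
    (flipMap a b c τ b ∉ breaks a b ∧ flipMap a b c τ (flipMap a b c τ b) ∉ breaks a b) ∧
    flipMap a b c τ (flipMap a b c τ (flipMap a b c τ b)) =
      renormIncl a b (flipMap (a - b) b (c - b) (τ - b) b) := by
  obtain ⟨hb, hba, hbc, haτ, hcτ, hτa, hτc, hbτ, hτs⟩ := h
  have ha : 0 ≤ a := by linarith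
  rw [flipMap_break_wrap (by simp) (by linarith),
    flipMap_left hb.le (by linarith) (by linarith) (by linarith),
    flipMap_right_wrap ha hb.le (by linarith) (by linarith),
    flipMap_break_wrap (by simp) (by linarith), renormIncl, if_neg (by linarith)]
  simp only [mem_breaks]
  grind

theorem renorm_right_cut (h : Renormalizable a b c τ) (hτ : c = τ) :
    flipMap a b c τ b = renormIncl a b (flipMap (a - b) b (c - b) (τ - b) b) := by
  have := h.pos
  rw [flipMap_break_wrap (by simp) (by linarith), flipMap_break_wrap (by simp) (by linarith),
    renormIncl, if_pos (by linarith)]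
  linarith

theorem flipMap_neg_left (h : Renormalizable a b c τ) : flipMap a b c τ (-a) = τ - a := by
  obtain ⟨hb, hba, hbc, haτ, hcτ, hτa, hτc, hbτ, hτs⟩ := h
  rw [flipMap_break (by simp) (by linarith)]
  ring

theorem renorm_left (h : Renormalizable a b c τ) :
    flipMap (a - b) b (c - b) (τ - b) (b - a) = τ - a := by
  obtain ⟨hb, hba, hbc, haτ, hcτ, hτa, hτc, hbτ, hτs⟩ := h
  rw [flipMap_break (by simp) (by linarith)]
  ring

theorem renorm_step (h : Renormalizable a b c τ) (hx : x ∈ Set.Ico (b - a) c) :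
    ∃ n, 0 < n ∧ (flipMap a b c τ)^[n] (renormIncl a b x) =
      renormIncl a b (flipMap (a - b) b (c - b) (τ - b) x) := by
  by_cases hv : x = b - a
  · refine ⟨1, one_pos, ?_⟩
    rw [Function.iterate_one, hv, renorm_left h, renormIncl, renormIncl, if_pos rfl,
      flipMap_neg_left h, if_neg]
    have := h.mid_lt
    intro _
    linarith
  rw [show renormIncl a b x = x by rw [renormIncl, if_neg hv]]
  by_cases hout : x < 0 ∨ b < x
  · exact ⟨1, one_pos, renorm_outer h hx hout hv⟩
  push Not at hout
  rcases hout.1.eq_or_lt with h₀ | h₀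
  · subst h₀
    rcases h.le_add_right.eq_or_lt with hτ | hτ
    · exact ⟨1, one_pos, renorm_zero_cut hτ⟩
    · refine ⟨3, by norm_num, (renorm_zero h (h.le_left.lt_of_ne ?_) hτ).2⟩
      rintro rfl
      simp at hv
  rcases hout.2.eq_or_lt with h₁ | h₁
  · subst h₁
    rcases h.right_le.eq_or_lt with hτ | hτ
    · exact ⟨1, one_pos, renorm_right_cut h hτ⟩
    · exact ⟨3, by norm_num, (renorm_right h hx.2 hτ).2⟩
  by_cases hu : x = τ - c
  · exact ⟨1, one_pos, renorm_cut h h₀ h₁ hu⟩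
  · exact ⟨3, by norm_num, (renorm_inner h h₀ h₁ hu).2⟩

theorem Renormalizable.renorm_mem (h : Renormalizable a b c τ) (hx : x ∈ Set.Ico (b - a) c) :
    flipMap (a - b) b (c - b) (τ - b) x ∈ Set.Ico (b - a) c := by
  obtain ⟨hb, hba, hbc, haτ, hcτ, hτa, hτc, hbτ, hτs⟩ := h
  have := flipMap_mem (a := a - b) (b := b) (c := c - b) (τ := τ - b) (x := x) (by linarith)
    (by linarith) (by linarith) (by linarith) (by linarith)
    ⟨by linarith [hx.1], by linarith [hx.2]⟩
  exact ⟨by linarith [this.1], by linarith [this.2]⟩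

theorem Renormalizable.incl_mem (h : Renormalizable a b c τ) (hx : x ∈ Set.Ico (b - a) c) :
    renormIncl a b x ∈ Set.Ico (-a) (b + c) := by
  obtain ⟨hb, hba, hbc, haτ, hcτ, hτa, hτc, hbτ, hτs⟩ := h
  obtain ⟨h₁, h₂⟩ := hx
  unfold renormIncl
  split_ifs <;> constructor <;> linarith

theorem renorm_iterate (h : Renormalizable a b c τ) (hx : x ∈ Set.Ico (b - a) c) (m : ℕ) :
    ∃ n, m ≤ n ∧ (flipMap a b c τ)^[n] (renormIncl a b x) =
      renormIncl a b ((flipMap (a - b) b (c - b) (τ - b))^[m] x) := by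
  induction m with
  | zero => exact ⟨0, le_rfl, rfl⟩
  | succ m ih =>
    obtain ⟨n, hn, he⟩ := ih
    obtain ⟨k, hk, hk'⟩ := renorm_step h (iterate_mem (fun _ => h.renorm_mem) hx m)
    refine ⟨k + n, by omega, ?_⟩
    rw [Function.iterate_add_apply, he, hk', Function.iterate_succ_apply']

theorem HasPeriodic.of_renorm (h : Renormalizable a b c τ)
    (hp : HasPeriodic (a - b) b (c - b) (τ - b)) : HasPeriodic a b c τ := by
  obtain ⟨x, hx, m, hm, hper⟩ := hp
  have hx' : x ∈ Set.Ico (b - a) c := ⟨by linarith [hx.1], by linarith [hx.2]⟩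
  obtain ⟨n, hn, he⟩ := renorm_iterate h hx' m
  refine ⟨_, h.incl_mem hx', n, by omega, ?_⟩
  rw [Function.IsPeriodicPt, Function.IsFixedPt, he, hper]

/-! ### Regular orbits -/

theorem regularSet_flipMap (h : Renormalizable a b c τ) (hx : x ∈ regularSet a b c τ) :
    flipMap a b c τ x ∈ regularSet a b c τ := by
  obtain ⟨hb, hba, hbc, haτ, hcτ, hτa, hτc, hbτ, hτs⟩ := h
  exact ⟨flipMap_mem (by linarith) (by linarith) (by linarith) (by linarith) (by linarith) hx.1,
    fun n => hx.2 (n + 1)⟩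

theorem regularSet_renorm (h : Renormalizable a b c τ) (hx : x ∈ regularSet a b c τ)
    (h₁ : b - a < x) (h₂ : x < c) : x ∈ regularSet (a - b) b (c - b) (τ - b) := by
  refine ⟨⟨by linarith, by linarith⟩, fun m hm => ?_⟩
  obtain ⟨n, -, he⟩ := renorm_iterate h ⟨h₁.le, h₂⟩ m
  rw [renormIncl, if_neg h₁.ne'] at he
  refine hx.2 n ?_
  rw [he]
  -- The inclusion carries the endpoints of the small map to those of the large one.
  rcases mem_breaks.1 hm with hm | hm | hm <;> rw [renormIncl, hm] <;> split_ifs <;>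
    simp only [mem_breaks] <;> grind

theorem regularInterval_image {k y : ℝ} (h : Renormalizable a b c τ)
    (hx : Set.Ioo x y ⊆ regularSet a b c τ)
    (hf : ∀ z ∈ Set.Ioo x y, flipMap a b c τ z = k - z) :
    Set.Ioo (k - y) (k - x) ⊆ regularSet a b c τ := by
  intro z hz
  have hz' : k - z ∈ Set.Ioo x y := ⟨by linarith [hz.2], by linarith [hz.1]⟩
  have := regularSet_flipMap h (hx hz')
  rwa [hf _ hz', sub_sub_cancel] at this

theorem regularInterval_side {y p : ℝ} (hp : p ∈ breaks a b)
    (hx : Set.Ioo x y ⊆ regularSet a b c τ) : y ≤ p ∨ p ≤ x := by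
  by_contra! hcon
  exact (hx ⟨hcon.2, hcon.1⟩).2 0 hp

theorem regularInterval_inner {w : ℝ} (h : Renormalizable a b c τ)
    (hx : Set.Ioo x (x + w) ⊆ regularSet a b c τ) (h₁ : b - a ≤ x) (h₂ : x + w ≤ c) :
    HasRegularInterval (a - b) b (c - b) (τ - b) w :=
  ⟨x, fun _ hz => regularSet_renorm h (hx hz) (h₁.trans_lt hz.1) (hz.2.trans_le h₂)⟩

/-- A regular interval contains no endpoint, so each step moves it isometrically. At most two steps
bring it into `[b - a, c)`: if the first image still sticks out, the second step completes a
translation by `b` towards the centre. -/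
theorem HasRegularInterval.renorm {w : ℝ} (hw : 0 < w) (h : Renormalizable a b c τ)
    (hI : HasRegularInterval a b c τ w) : HasRegularInterval (a - b) b (c - b) (τ - b) w := by
  obtain ⟨x, hx⟩ := hI
  have h' := h
  obtain ⟨hb, hba, hbc, haτ, hcτ, hτa, hτc, hbτ, hτs⟩ := h'
  have h0 := regularInterval_side (p := 0) (by simp [mem_breaks]) hx
  have hb' := regularInterval_side (p := b) (by simp [mem_breaks]) hx
  have hlo : -a ≤ x := by
    by_contra! hcon
    have := (hx (a := min (x + w / 2) ((x - a) / 2)) ⟨lt_min (by linarith) (by linarith),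
      min_lt_of_left_lt (by linarith)⟩).1.1
    linarith [min_le_right (x + w / 2) ((x - a) / 2)]
  have hhi : x + w ≤ b + c := by
    by_contra! hcon
    have := (hx (a := max (x + w / 2) ((x + w + (b + c)) / 2)) ⟨lt_max_of_lt_left (by linarith),
      max_lt (by linarith) (by linarith)⟩).1.2
    linarith [le_max_right (x + w / 2) ((x + w + (b + c)) / 2)]
  rcases h0 with h0 | h0
  · by_cases hin : b - a ≤ x
    · exact regularInterval_inner h hx hin (by linarith)
    have hf : ∀ z ∈ Set.Ioo x (x + w), flipMap a b c τ z = (τ - a) - z := by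
      intro z hz
      rw [flipMap_left hb.le (by linarith [hz.1]) (by linarith [hz.2]) (by linarith [hz.1])]
      ring
    have hx₁ := regularInterval_image h hx hf
    rcases regularInterval_side (p := b) (by simp [mem_breaks]) hx₁ with hs | hs
    · rw [show τ - a - x = τ - a - (x + w) + w by ring] at hx₁
      exact regularInterval_inner h hx₁ (by linarith) (by linarith)
    · have hf₁ : ∀ z ∈ Set.Ioo (τ - a - (x + w)) (τ - a - x),
          flipMap a b c τ z = (b + τ - a) - z := by
        intro z hz
        rw [flipMap_right_wrap (by linarith) hb.le (by linarith [hz.1]) (by linarith [hz.2])]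
        ring
      have hx₂ := regularInterval_image h hx₁ hf₁
      rw [show b + τ - a - (τ - a - x) = x + b by ring,
        show b + τ - a - (τ - a - (x + w)) = x + b + w by ring] at hx₂
      exact regularInterval_inner h hx₂ (by linarith) (by linarith)
  rcases hb' with hb' | hb'
  · exact regularInterval_inner h hx (by linarith) (by linarith)
  by_cases hin : x + w ≤ c
  · exact regularInterval_inner h hx (by linarith) hin
  have hf : ∀ z ∈ Set.Ioo x (x + w), flipMap a b c τ z = (b + τ - a) - z := by
    intro z hz
    rw [flipMap_right_wrap (by linarith) hb.le (by linarith [hz.1]) (by linarith [hz.2])]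
    ring
  have hx₁ := regularInterval_image h hx hf
  rcases regularInterval_side (p := 0) (by simp [mem_breaks]) hx₁ with hs | hs
  · have hf₁ : ∀ z ∈ Set.Ioo (b + τ - a - (x + w)) (b + τ - a - x),
        flipMap a b c τ z = (τ - a) - z := by
      intro z hz
      rw [flipMap_left hb.le (by linarith [hz.1]) (by linarith [hz.2]) (by linarith [hz.1])]
      ring
    have hx₂ := regularInterval_image h hx₁ hf₁
    rw [show τ - a - (b + τ - a - x) = x - b by ring,
      show τ - a - (b + τ - a - (x + w)) = x - b + w by ring] at hx₂
    exact regularInterval_inner h hx₂ (by linarith) (by linarith)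
  · have hs' := regularInterval_side (p := b) (by simp [mem_breaks]) hx₁
    rw [show b + τ - a - x = b + τ - a - (x + w) + w by ring] at hx₁ hs'
    rcases hs' with hs' | hs'
    · exact regularInterval_inner h hx₁ (by linarith) (by linarith)
    · exact regularInterval_inner h hx₁ (by linarith) (by linarith)

/-! ### Connections -/

/-- The renormalization step is strict: no endpoint of an arc is hit by accident. -/
structure StrictlyRenormalizable (a b c τ : ℝ) : Prop extends Renormalizable a b c τ where
  lt_left : b < a
  lt_right : b < c
  left_lt : a < τ
  right_lt : c < τ
  lt_left_add : τ < a + b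
  lt_add_right : τ < b + c

/-- The points skipped by the three-step returns are not endpoints, so a visit to an endpoint is
seen by the induced map, and no later. -/
theorem renorm_break_of_break (h : StrictlyRenormalizable a b c τ) (m : ℕ) :
    ∀ x ∈ Set.Ico (b - a) c, (flipMap a b c τ)^[m] (renormIncl a b x) ∈ breaks a b →
      ∃ m' ≤ m, (flipMap (a - b) b (c - b) (τ - b))^[m'] x ∈ breaks (a - b) b := by
  obtain ⟨h', hba, hbc, haτ, hcτ, hτa, hτc⟩ := h
  have hb := h'.pos
  induction m using Nat.strong_induction_on with
  | _ m ih =>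
    intro x hx hm
    by_cases hxb : x ∈ breaks (a - b) b
    · exact ⟨0, by omega, hxb⟩
    have hxv : x ≠ b - a := fun hx' => hxb (Or.inl (by rw [hx']; ring))
    have hx0 : x ≠ 0 := fun hx' => hxb (Or.inr (Or.inl hx'))
    have hxb' : x ≠ b := fun hx' => hxb (Or.inr (Or.inr hx'))
    rw [show renormIncl a b x = x by rw [renormIncl, if_neg hxv]] at hm
    rcases m with _ | m
    · have := hx.1
      rcases mem_breaks.1 hm with hm | hm | hm
      · simp at hm
        linarith
      · exact absurd hm hx0
      · exact absurd hm hxb'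
    have one (he : flipMap a b c τ x =
        renormIncl a b (flipMap (a - b) b (c - b) (τ - b) x)) :
        ∃ m' ≤ m + 1, (flipMap (a - b) b (c - b) (τ - b))^[m'] x ∈ breaks (a - b) b := by
      rw [Function.iterate_succ_apply, he] at hm
      obtain ⟨m', hm', h⟩ := ih m (by omega) _ (h'.renorm_mem hx) hm
      exact ⟨m' + 1, by omega, h⟩
    by_cases hout : x < 0 ∨ b < x
    · exact one (renorm_outer h' hx hout hxv)
    push Not at hout
    have h₀ := hout.1.lt_of_ne hx0.symm
    have h₁ := hout.2.lt_of_ne hxb'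
    by_cases hu : x = τ - c
    · exact one (renorm_cut h' h₀ h₁ hu)
    obtain ⟨⟨hn₁, hn₂⟩, he⟩ := renorm_inner h' h₀ h₁ hu
    match m, hm, ih with
    | 0, hm, _ => exact absurd hm hn₁
    | 1, hm, _ => exact absurd hm hn₂
    | m + 2, hm, ih =>
      rw [Function.iterate_succ_apply, Function.iterate_succ_apply, Function.iterate_succ_apply,
        he] at hm
      obtain ⟨m', hm', h⟩ := ih m (by omega) _ (h'.renorm_mem hx) hm
      exact ⟨m' + 1, by omega, h⟩

theorem renorm_break_of_return (h : StrictlyRenormalizable a b c τ) {m : ℕ}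
    (hx : x ∈ Set.Ico (b - a) c)
    (hr : (flipMap a b c τ x ∉ breaks a b ∧ flipMap a b c τ (flipMap a b c τ x) ∉ breaks a b) ∧
      flipMap a b c τ (flipMap a b c τ (flipMap a b c τ x)) =
        renormIncl a b (flipMap (a - b) b (c - b) (τ - b) x))
    (hm : (flipMap a b c τ)^[m + 1] x ∈ breaks a b) :
    ∃ m' < m, (flipMap (a - b) b (c - b) (τ - b))^[m' + 1] x ∈ breaks (a - b) b := by
  obtain ⟨⟨hn₁, hn₂⟩, he⟩ := hr
  match m, hm with
  | 0, hm => exact absurd hm hn₁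
  | 1, hm => exact absurd hm hn₂
  | m + 2, hm =>
    rw [Function.iterate_succ_apply, Function.iterate_succ_apply, Function.iterate_succ_apply,
      he] at hm
    obtain ⟨m', hm', h⟩ := renorm_break_of_break h m _ (h.toRenormalizable.renorm_mem hx) hm
    exact ⟨m', by omega, h⟩

/-- The decrease is strict because some return within the connection takes three steps: the first
one from `0` or `b`, the second one from `-a`, which first goes to `τ - a` under both maps. If `a =
c`, then `τ - a` is the cut point and returns to `-a` in one step, so nothing would be gained. -/
theorem HasConnection.renorm (h : StrictlyRenormalizable a b c τ) (hac : a ≠ c) {m : ℕ}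
    (hm : HasConnection a b c τ (m + 1)) :
    ∃ m' < m, HasConnection (a - b) b (c - b) (τ - b) (m' + 1) := by
  obtain ⟨h', hba, hbc, haτ, hcτ, hτa, hτc⟩ := h
  have hs : StrictlyRenormalizable a b c τ := ⟨h', hba, hbc, haτ, hcτ, hτa, hτc⟩
  have hb := h'.pos
  obtain ⟨x, hx, hm⟩ := hm
  rcases mem_breaks.1 hx with rfl | rfl | rfl
  · rw [Function.iterate_succ_apply, flipMap_neg_left h'] at hm
    have hq := renorm_inner h' (x := τ - a) (by linarith) (by linarith)
      (fun h => hac (by linarith))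
    rcases m with _ | m
    · rcases mem_breaks.1 hm with hm | hm | hm <;> simp at hm <;> linarith
    · obtain ⟨m', hm', he⟩ := renorm_break_of_return hs ⟨by linarith, by linarith⟩ hq hm
      refine ⟨m' + 1, by omega, b - a, Or.inl (by ring), ?_⟩
      rwa [Function.iterate_succ_apply, renorm_left h']
  · obtain ⟨m', hm', he⟩ := renorm_break_of_return hs ⟨by linarith, by linarith⟩
      (renorm_zero h' hba hτc) hm
    exact ⟨m', hm', 0, by simp [mem_breaks], he⟩
  · obtain ⟨m', hm', he⟩ := renorm_break_of_return hs ⟨by linarith, by linarith⟩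
      (renorm_right h' hbc hcτ) hm
    exact ⟨m', hm', x, by simp [mem_breaks], he⟩

end Renormalization

/-! ### Relabelling for arcs indexed by `Fin 3`. -/

section Relabelling

/-- A property of the three arcs that survives the cyclic relabelling does not depend on which arc
is put in the middle. -/
theorem relabel_all {l : Fin 3 → ℝ} {P : ℝ → ℝ → ℝ → Prop}
    (hP : ∀ j, P (l (j + 2)) (l j) (l (j + 1)) → P (l j) (l (j + 1)) (l (j + 2)))
    (i j : Fin 3) (h : P (l (i + 2)) (l i) (l (i + 1))) : P (l (j + 2)) (l j) (l (j + 1)) := by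
  have h0 := hP 0
  have h1 := hP 1
  have h2 := hP 2
  fin_cases i <;> fin_cases j <;> simp_all

theorem sum_eq_around (l : Fin 3 → ℝ) (j : Fin 3) :
    ∑ i, l i = l (j + 2) + l j + l (j + 1) := by
  rw [Fin.sum_univ_three]
  fin_cases j <;> simp <;> ring

variable {l : Fin 3 → ℝ} {τ : ℝ}

theorem HasPeriodic.relabel_all (hl : ∀ i, 0 ≤ l i) (hτ : 0 ≤ τ) (hτs : τ ≤ ∑ i, l i)
    (i j : Fin 3) (h : HasPeriodic (l (i + 2)) (l i) (l (i + 1)) τ) :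
    HasPeriodic (l (j + 2)) (l j) (l (j + 1)) τ :=
  _root_.relabel_all (P := fun a b c => HasPeriodic a b c τ) (fun k hk =>
    hk.relabel (hl _) (hl _) (hl _) hτ (by rwa [sum_eq_around l k] at hτs)) i j h

theorem HasConnection.relabel_all (hl : ∀ i, 0 < l i) (hτ : 0 ≤ τ) (hτs : τ ≤ ∑ i, l i)
    {n : ℕ} (i j : Fin 3) (h : HasConnection (l (i + 2)) (l i) (l (i + 1)) τ n) :
    HasConnection (l (j + 2)) (l j) (l (j + 1)) τ n :=
  _root_.relabel_all (P := fun a b c => HasConnection a b c τ n) (fun k hk =>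
    hk.relabel (hl _).le (hl _).le (hl _) hτ (by rwa [sum_eq_around l k] at hτs)) i j h

theorem HasRegularInterval.relabel_all (hl : ∀ i, 0 < l i) (hτ : 0 ≤ τ) (hτs : τ ≤ ∑ i, l i)
    {w : ℝ} (i j : Fin 3) (h : HasRegularInterval (l (i + 2)) (l i) (l (i + 1)) τ w) :
    HasRegularInterval (l (j + 2)) (l j) (l (j + 1)) τ w :=
  _root_.relabel_all (P := fun a b c => HasRegularInterval a b c τ w) (fun k hk =>
    hk.relabel (hl _).le (hl _).le (hl _) hτ (by rwa [sum_eq_around l k] at hτs)) i j h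

end Relabelling

/-! ### The subtraction process on lengths and its consequences for orbits. -/

section Subtraction

/-- Subtract the arc `j` from the two others. -/
def subtractArc (j : Fin 3) (l : Fin 3 → ℝ) : Fin 3 → ℝ :=
  fun i => if i = j then l j else l i - l j

theorem subtractArc_self (j : Fin 3) (l : Fin 3 → ℝ) : subtractArc j l j = l j := by
  simp [subtractArc]

theorem subtractArc_of_ne {i j : Fin 3} (h : i ≠ j) (l : Fin 3 → ℝ) :
    subtractArc j l i = l i - l j := by
  simp [subtractArc, h]

theorem subtractArc_add_one (j : Fin 3) (l : Fin 3 → ℝ) :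
    subtractArc j l (j + 1) = l (j + 1) - l j :=
  subtractArc_of_ne (by fin_cases j <;> decide) l

theorem subtractArc_add_two (j : Fin 3) (l : Fin 3 → ℝ) :
    subtractArc j l (j + 2) = l (j + 2) - l j :=
  subtractArc_of_ne (by fin_cases j <;> decide) l

theorem sum_subtractArc (j : Fin 3) (l : Fin 3 → ℝ) :
    ∑ i, subtractArc j l i = ∑ i, l i - 2 * l j := by
  rw [sum_eq_around _ j, sum_eq_around l j, subtractArc_self, subtractArc_add_one,
    subtractArc_add_two]
  ring

/-- An infinite subtraction process in which no arc ever exceeds half of the circle exhausts the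
circle. -/
theorem tendsto_sum_of_subtractArc {l : ℕ → Fin 3 → ℝ} {j : ℕ → Fin 3}
    (hstep : ∀ n, l (n + 1) = subtractArc (j n) (l n)) (hpos : ∀ n i, 0 < l n i)
    (hhalf : ∀ n i, 2 * l n i ≤ ∑ k, l n k) :
    Tendsto (fun n => ∑ i, l n i) atTop (𝓝 0) := by
  have hanti (i : Fin 3) : Antitone fun n => l n i := by
    refine antitone_nat_of_succ_le fun n => ?_
    rw [hstep]
    by_cases h : i = j n
    · rw [h, subtractArc_self]
    · rw [subtractArc_of_ne h]
      linarith [hpos n (j n)]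
  have hlim (i : Fin 3) : ∃ L, Tendsto (fun n => l n i) atTop (𝓝 L) :=
    ⟨_, tendsto_atTop_ciInf (hanti i) ⟨0, by rintro _ ⟨n, rfl⟩; exact (hpos n i).le⟩⟩
  choose L hL using hlim
  have hLl (n : ℕ) (i : Fin 3) : L i ≤ l n i := (hanti i).le_of_tendsto (hL i) n
  have hL0 (i : Fin 3) : 0 ≤ L i := ge_of_tendsto' (hL i) fun n => (hpos n i).le
  have hsum : Tendsto (fun n => ∑ i, l n i) atTop (𝓝 (∑ i, L i)) :=
    tendsto_finsetSum _ fun i _ => hL i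
  have hLhalf (i : Fin 3) : 2 * L i ≤ ∑ k, L k :=
    le_of_tendsto_of_tendsto' ((hL i).const_mul 2) hsum fun n => hhalf n i
  -- Each step lowers the convergent total by twice the subtracted length.
  have hmin : Tendsto (fun n => l n (j n)) atTop (𝓝 0) := by
    have h := (hsum.sub (hsum.comp (tendsto_add_atTop_nat 1))).div_const 2
    rw [sub_self, zero_div] at h
    refine h.congr fun n => ?_
    simp only [Function.comp_apply, hstep, sum_subtractArc]
    ring
  suffices h : ∑ i, L i = 0 by rwa [h] at hsum
  by_contra hne
  have hS : 0 < ∑ i, L i := lt_of_le_of_ne (Finset.sum_nonneg fun i _ => hL0 i) (Ne.symm hne)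
  -- Two vanishing limits would leave the third equal to the whole positive total, against the half
  -- bound.
  obtain ⟨k, hk⟩ : ∃ k, ∀ i, i ≠ k → 0 < L i := by
    have h0 := hLhalf 0
    have h1 := hLhalf 1
    have h2 := hLhalf 2
    have hn := hL0 0
    have hn' := hL0 1
    rw [Fin.sum_univ_three] at hS h0 h1 h2
    by_cases h : L 0 = 0
    · refine ⟨0, fun i hi => ?_⟩
      fin_cases i <;> first | exact absurd rfl hi | (simp only [Fin.reduceFinMk]; linarith)
    have hp : 0 < L 0 := lt_of_le_of_ne hn (Ne.symm h)
    by_cases h' : L 1 = 0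
    · refine ⟨1, fun i hi => ?_⟩
      fin_cases i <;> first | exact absurd rfl hi | exact hp | (simp only [Fin.reduceFinMk]; linarith)
    · refine ⟨2, fun i hi => ?_⟩
      fin_cases i <;> first | exact absurd rfl hi | exact hp | exact lt_of_le_of_ne hn' (Ne.symm h')
  -- Subtracted lengths tend to zero, so an arc with positive limit is not subtracted late. Thus `k`
  -- alone is subtracted, and its length stays constant and positive: a contradiction.
  have hev : ∀ᶠ n in atTop, j n = k := by
    have (i : Fin 3) : ∀ᶠ n in atTop, i ≠ k → j n ≠ i := by
      by_cases hi : i = k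
      · simp [hi]
      · filter_upwards [hmin.eventually (gt_mem_nhds (hk i hi))] with n hn _ h
        rw [h] at hn
        linarith [hLl n i]
    filter_upwards [eventually_all.2 this] with n hn
    by_contra h
    exact hn _ h rfl
  obtain ⟨N, hN⟩ := eventually_atTop.1 hev
  have hconst (n : ℕ) (hn : N ≤ n) : l n k = l N k := by
    induction n, hn using Nat.le_induction with
    | base => rfl
    | succ n hn ih => rw [hstep, hN n hn, subtractArc_self, ih]
  have : Tendsto (fun _ : ℕ => l N k) atTop (𝓝 0) := hmin.congr' <| by
    filter_upwards [eventually_ge_atTop N] with n hn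
    rw [hN n hn, hconst n hn]
  linarith [hpos N k, tendsto_const_nhds_iff.1 this]

/-- The lengths admit an infinite process of strict subtractions, with all arcs positive and
shorter than half of the circle at every step. -/
def Inexhaustible (l : Fin 3 → ℝ) : Prop :=
  ∃ (L : ℕ → Fin 3 → ℝ) (j : ℕ → Fin 3), L 0 = l ∧
    ∀ n, L (n + 1) = subtractArc (j n) (L n) ∧ ∀ i, 0 < L n i ∧ 2 * L n i < ∑ k, L n k

/-- With `y i = 1 - 2 * l i / total`, subtracting arc `j` is the Rauzy step `j`: the total is
multiplied by `y j`. Positivity of `y` is the half bound, and `1 / 2 < y j` is the half bound for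
arc `j` after the step. -/
theorem inexhaustible_iff {l : Fin 3 → ℝ} (hl : ∑ i, l i = 1) :
    Inexhaustible l ↔ (fun j => 1 - 2 * l j) ∈ rauzyGasket := by
  constructor
  · rintro ⟨L, j, h0, h⟩
    have hs (n : ℕ) : 0 < ∑ k, L n k := Finset.sum_pos (fun i _ => ((h n).2 i).1) ⟨0, by simp⟩
    refine ⟨fun i => ?_, ?_, fun n i => 1 - 2 * L n i / ∑ k, L n k, ?_, fun n => ⟨j n, ?_, ?_⟩⟩
    · have := ((h 0).2 i).2
      rw [h0, hl] at this
      linarith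
    · rw [Fin.sum_univ_three] at hl ⊢
      linarith
    · simp [h0, hl]
    · have := ((h (n + 1)).2 (j n)).2
      rw [(h n).1, sum_subtractArc, subtractArc_self] at this
      have h4 : 2 * L n (j n) / (∑ k, L n k) < 1 / 2 := by
        rw [div_lt_iff₀ (hs n)]
        linarith
      linarith
    · have h1 := ((h n).2 (j n)).2
      have h2 := (hs n).ne'
      have h3 : ∑ k, L n k - 2 * L n (j n) ≠ 0 := by linarith
      funext i
      simp only [rauzyStep, (h n).1, sum_subtractArc]
      by_cases hi : i = j n
      · rw [hi, subtractArc_self, if_pos rfl]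
        field_simp
        ring
      · rw [subtractArc_of_ne hi, if_neg hi]
        field_simp
        ring
  · rintro ⟨hpos, hsum, y, hy0, hy⟩
    choose j hj hy using hy
    let L : ℕ → Fin 3 → ℝ := fun n => Nat.rec l (fun n z => subtractArc (j n) z) n
    have hL (n : ℕ) : L (n + 1) = subtractArc (j n) (L n) := rfl
    have key (n : ℕ) : 0 < ∑ k, L n k ∧
        ∀ i, y n i = 1 - 2 * L n i / (∑ k, L n k) ∧ 0 < y n i := by
      induction n with
      | zero =>
        have : L 0 = l := rfl
        rw [this, hl, hy0]
        exact ⟨one_pos, fun i => ⟨by simp, hpos i⟩⟩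
      | succ n ih =>
        obtain ⟨hs, ih⟩ := ih
        have h2 := hs.ne'
        have h1 : 2 * L n (j n) / (∑ k, L n k) < 1 / 2 := by linarith [(ih (j n)).1, hj n]
        rw [div_lt_iff₀ hs] at h1
        have h3 : 0 < ∑ k, L n k - 2 * L n (j n) := by linarith
        rw [hL, sum_subtractArc]
        refine ⟨h3, fun i => ?_⟩
        have hjp : 0 < y n (j n) := (ih _).2
        rw [hy, rauzyStep]
        by_cases hi : i = j n
        · rw [hi, subtractArc_self, if_pos rfl]
          refine ⟨?_, div_pos (by linarith [hj n]) hjp⟩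
          rw [(ih (j n)).1]
          have := h3.ne'
          field_simp
          ring
        · rw [subtractArc_of_ne hi, if_neg hi]
          refine ⟨?_, div_pos (ih i).2 hjp⟩
          rw [(ih (j n)).1, (ih i).1]
          have := h3.ne'
          field_simp
          ring
    have half (n : ℕ) (i : Fin 3) : 2 * L n i < ∑ k, L n k := by
      obtain ⟨hs, h⟩ := key n
      have : 2 * L n i / (∑ k, L n k) < 1 := by linarith [(h i).1, (h i).2]
      rwa [div_lt_one hs] at this
    refine ⟨L, j, rfl, fun n => ⟨hL n, fun i => ⟨?_, half n i⟩⟩⟩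
    -- Adding the half bounds of the two other arcs gives positivity of this one.
    have h1 := half n (i + 1)
    have h2 := half n (i + 2)
    rw [sum_eq_around (L n) i] at h1 h2
    linarith

theorem Inexhaustible.pos {l : Fin 3 → ℝ} (h : Inexhaustible l) (i : Fin 3) : 0 < l i := by
  obtain ⟨L, j, rfl, h⟩ := h
  exact ((h 0).2 i).1

theorem Inexhaustible.half {l : Fin 3 → ℝ} (h : Inexhaustible l) (i : Fin 3) :
    2 * l i < ∑ k, l k := by
  obtain ⟨L, j, rfl, h⟩ := h
  exact ((h 0).2 i).2

theorem Inexhaustible.next {l : Fin 3 → ℝ} (h : Inexhaustible l) :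
    ∃ j, Inexhaustible (subtractArc j l) := by
  obtain ⟨L, j, rfl, h⟩ := h
  exact ⟨j 0, fun n => L (n + 1), fun n => j (n + 1), (h 0).1, fun n => h (n + 1)⟩

/-- Subtracting either of two equal arcs would annihilate the other. So the third is subtracted
forever and keeps its length, although the total tends to zero. -/
theorem Inexhaustible.injective {l : Fin 3 → ℝ} (h : Inexhaustible l) {p q : Fin 3} (hpq : p ≠ q) :
    l p ≠ l q := by
  obtain ⟨L, j, rfl, h⟩ := h
  intro heq
  have hne (n : ℕ) (he : L n p = L n q) : j n ≠ p ∧ j n ≠ q := by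
    constructor
    · intro hj
      have := ((h (n + 1)).2 q).1
      rw [(h n).1, hj, subtractArc_of_ne hpq.symm] at this
      linarith
    · intro hj
      have := ((h (n + 1)).2 p).1
      rw [(h n).1, hj, subtractArc_of_ne hpq] at this
      linarith
  have hall (n : ℕ) : L n p = L n q := by
    induction n with
    | zero => exact heq
    | succ n ih =>
      rw [(h n).1, subtractArc_of_ne (hne n ih).1.symm, subtractArc_of_ne (hne n ih).2.symm, ih]
  have hj (n : ℕ) : j n = j 0 := by
    have h1 := hne n (hall n)
    have h2 := hne 0 (hall 0)
    omega
  have hconst (n : ℕ) : L n (j 0) = L 0 (j 0) := by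
    induction n with
    | zero => rfl
    | succ n ih => rw [(h n).1, hj n, subtractArc_self, ih]
  have ht := tendsto_sum_of_subtractArc (fun n => (h n).1) (fun n i => ((h n).2 i).1)
    (fun n i => ((h n).2 i).2.le)
  have := ge_of_tendsto' ht fun n => (hconst n) ▸
    Finset.single_le_sum (f := L n) (fun i _ => ((h n).2 i).1.le) (Finset.mem_univ (j 0))
  linarith [((h 0).2 (j 0)).1]

theorem strictlyRenormalizable {l : Fin 3 → ℝ} {j : Fin 3} (hpos : ∀ i, 0 < l i)
    (hhalf : ∀ i, 2 * l i < ∑ k, l k) (hnext : ∀ i, 0 < subtractArc j l i) :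
    StrictlyRenormalizable (l (j + 2)) (l j) (l (j + 1)) ((∑ k, l k) / 2) := by
  have h1 := hnext (j + 1)
  have h2 := hnext (j + 2)
  rw [subtractArc_add_one] at h1
  rw [subtractArc_add_two] at h2
  have h3 := hhalf j
  have h4 := hhalf (j + 1)
  have h5 := hhalf (j + 2)
  have h6 := hpos j
  rw [sum_eq_around l j] at *
  constructor <;> first | constructor <;> linarith | linarith

/-- Infinite descent on the length of the connection. The length is written `m + 1` because
connections of length zero are trivial. -/
theorem not_hasConnection (m : ℕ) : ∀ l : Fin 3 → ℝ, Inexhaustible l → ∀ i : Fin 3,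
    ¬ HasConnection (l (i + 2)) (l i) (l (i + 1)) ((∑ k, l k) / 2) (m + 1) := by
  induction m using Nat.strong_induction_on with
  | _ m ih =>
    intro l hl i hcon
    have hs : 0 < ∑ k, l k := Finset.sum_pos (fun i _ => hl.pos i) ⟨0, by simp⟩
    obtain ⟨j, hj⟩ := hl.next
    have hr := strictlyRenormalizable hl.pos hl.half hj.pos
    have hcon := hcon.relabel_all hl.pos (by linarith) (by linarith) i j
    obtain ⟨m', hm', hc⟩ := hcon.renorm hr (hl.injective (by fin_cases j <;> decide))
    refine ih m' hm' _ hj j ?_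
    rw [sum_subtractArc, subtractArc_self, subtractArc_add_one, subtractArc_add_two]
    convert hc using 1
    ring

theorem not_hasRegularInterval {l : Fin 3 → ℝ} (hl : Inexhaustible l) (i : Fin 3) {w : ℝ}
    (hw : 0 < w) :
    ¬ HasRegularInterval (l (i + 2)) (l i) (l (i + 1)) ((∑ k, l k) / 2) w := by
  intro hI
  obtain ⟨L, j, rfl, h⟩ := hl
  have hs (n : ℕ) : 0 < ∑ k, L n k := Finset.sum_pos (fun i _ => ((h n).2 i).1) ⟨0, by simp⟩
  have hall (n : ℕ) : HasRegularInterval (L n (i + 2)) (L n i) (L n (i + 1))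
      ((∑ k, L n k) / 2) w := by
    induction n with
    | zero => exact hI
    | succ n ih =>
      have hr := strictlyRenormalizable (j := j n) (fun i => ((h n).2 i).1)
        (fun i => ((h n).2 i).2) (fun i => by rw [← (h n).1]; exact ((h (n + 1)).2 i).1)
      have h1 := (ih.relabel_all (fun i => ((h n).2 i).1) (by linarith [hs n])
        (by linarith [hs n]) i (j n)).renorm hw hr.toRenormalizable
      refine HasRegularInterval.relabel_all (fun i => ((h (n + 1)).2 i).1)
        (by linarith [hs (n + 1)]) (by linarith [hs (n + 1)]) (j n) i ?_
      rw [(h n).1, sum_subtractArc, subtractArc_self, subtractArc_add_one, subtractArc_add_two]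
      convert h1 using 1
      ring
  have hlow (n : ℕ) : w ≤ ∑ k, L n k := by
    obtain ⟨x, hx⟩ := hall n
    have := closure_mono (hx.trans fun z hz => Set.Ico_subset_Icc_self hz.1)
    rw [closure_Ioo (by linarith), isClosed_Icc.closure_eq,
      Set.Icc_subset_Icc_iff (by linarith)] at this
    rw [sum_eq_around (L n) i]
    linarith [this.1, this.2]
  have ht := tendsto_sum_of_subtractArc (fun n => (h n).1) (fun n i => ((h n).2 i).1)
    (fun n i => ((h n).2 i).2.le)
  linarith [ge_of_tendsto' ht hlow]

end Subtraction

/-! ### Parameters that force a periodic point. -/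

section Periodic

/-- An arc that overlaps its rotated copy contains a fixed point of the reflection; the witnesses
solve `b - x + τ = x` without and with wrapping. -/
theorem HasPeriodic.of_long {a b c τ : ℝ} (ha : 0 ≤ a) (hc : 0 ≤ c) (hτ : 0 ≤ τ)
    (hτs : τ ≤ a + b + c) (h : τ < b ∨ a + b + c - τ < b) : HasPeriodic a b c τ := by
  rcases h with h | h
  · refine ⟨(b + τ) / 2, ⟨by linarith, by linarith⟩, 1, one_pos, ?_⟩
    rw [Function.IsPeriodicPt, Function.IsFixedPt, Function.iterate_one,
      flipMap_mid ha (by linarith) (by linarith) (by linarith)]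
    ring
  · refine ⟨(τ - a - c) / 2, ⟨by linarith, by linarith⟩, 1, one_pos, ?_⟩
    rw [Function.IsPeriodicPt, Function.IsFixedPt, Function.iterate_one,
      flipMap_mid_wrap ha (by linarith) (by linarith) (by linarith)]
    ring

theorem HasPeriodic.of_half {a b c : ℝ} (ha : 0 ≤ a) (hb : 0 < b) (hc : 0 ≤ c)
    (h : a + c = b) : HasPeriodic a b c b := by
  refine ⟨0, ⟨by linarith, by linarith⟩, 2, two_pos, ?_⟩
  simp only [Function.IsPeriodicPt, Function.IsFixedPt, Function.iterate_succ,
    Function.iterate_zero, Function.comp_apply, id]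
  rcases hc.eq_or_lt with h' | h'
  · rw [flipMap_break_wrap (x := 0) (by simp) (by linarith),
      flipMap_break (Or.inl (by linarith)) (by linarith)]
    linarith
  · rw [flipMap_break (x := 0) (by simp) (by linarith), zero_add,
      flipMap_break_wrap (by simp) (by linarith)]
    linarith

theorem HasPeriodic.of_eq {b τ : ℝ} (hb : 0 < b) (h : τ = b ∨ τ = 2 * b) :
    HasPeriodic b b b τ := by
  refine ⟨0, ⟨by linarith, by linarith⟩, 3, three_pos, ?_⟩
  simp only [Function.IsPeriodicPt, Function.IsFixedPt, Function.iterate_succ,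
    Function.iterate_zero, Function.comp_apply, id]
  rcases h with rfl | rfl
  · rw [flipMap_break (x := 0) (by simp) (by linarith), zero_add,
      flipMap_break_wrap (x := τ) (by simp) (by linarith),
      flipMap_break (Or.inl (by ring)) (by linarith)]
    ring
  · rw [flipMap_break_wrap (x := 0) (by simp) (by linarith),
      flipMap_break (x := 0 + 2 * b - (b + b + b)) (Or.inl (by ring)) (by linarith),
      flipMap_break_wrap (Or.inr (Or.inr (by ring))) (by linarith)]
    ring

/-- Without periodic points a renormalization step can be made. -/
theorem exists_subtractArc {l : Fin 3 → ℝ} {τ : ℝ} (hl : ∀ i, 0 ≤ l i) (hs : 0 < ∑ i, l i)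
    (hτ : 0 ≤ τ) (hτs : τ ≤ ∑ i, l i)
    (hper : ∀ i : Fin 3, ¬ HasPeriodic (l (i + 2)) (l i) (l (i + 1)) τ) :
    (∀ i, 0 < l i ∧ 2 * l i ≤ ∑ k, l k) ∧ (2 * τ = ∑ k, l k → ∀ i, 2 * l i < ∑ k, l k) ∧
    ∃ j, (∀ i, 0 ≤ subtractArc j l i) ∧ 0 < ∑ i, subtractArc j l i ∧ 0 ≤ τ - l j ∧
      τ - l j ≤ ∑ i, subtractArc j l i ∧
      ∀ i : Fin 3, ¬ HasPeriodic (subtractArc j l (i + 2)) (subtractArc j l i)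
        (subtractArc j l (i + 1)) (τ - l j) := by
  have hle (i : Fin 3) : l i ≤ τ ∧ l i ≤ ∑ k, l k - τ := by
    have hsi := sum_eq_around l i
    constructor
    · by_contra! hcon
      exact hper i (HasPeriodic.of_long (hl _) (hl _) hτ (by linarith) (Or.inl hcon))
    · by_contra! hcon
      exact hper i (HasPeriodic.of_long (hl _) (hl _) hτ (by linarith) (Or.inr (by linarith)))
  have hlt (h2 : 2 * τ = ∑ k, l k) (i : Fin 3) : 2 * l i < ∑ k, l k := by
    by_contra! hcon
    have hi : l i = τ := by linarith [(hle i).1]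
    have hsi := sum_eq_around l i
    refine hper i ?_
    rw [← hi]
    exact HasPeriodic.of_half (hl _) (by linarith) (hl _) (by linarith)
  -- If one arc vanished, the bounds `hle` would make the other two halves of the circle and `τ` a
  -- half, against `hlt`.
  have hpos (i : Fin 3) : 0 < l i := by
    refine lt_of_le_of_ne (hl i) fun h0 => ?_
    have hsi := sum_eq_around l i
    have h1 := hle (i + 1)
    have h2 := hle (i + 2)
    linarith [hlt (by linarith) (i + 1)]
  refine ⟨fun i => ⟨hpos i, by linarith [(hle i).1, (hle i).2]⟩, hlt, ?_⟩
  obtain ⟨j, hj⟩ := Finite.exists_min l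
  have hsj := sum_eq_around l j
  have hj1 := hj (j + 1)
  have hj2 := hj (j + 2)
  have h0 := hle j
  have h1 := hle (j + 1)
  have h2 := hle (j + 2)
  have hpj := hpos j
  have hnn (i : Fin 3) : 0 ≤ subtractArc j l i := by
    unfold subtractArc
    split_ifs
    · exact hl j
    · linarith [hj i]
  have hr : Renormalizable (l (j + 2)) (l j) (l (j + 1)) τ := by
    refine ⟨hpj, hj2, hj1, h2.1, h1.1, by linarith, by linarith, h0.1.lt_of_ne fun h => ?_,
      lt_of_le_of_ne (by linarith) fun h => ?_⟩
    -- Equality in either strict condition forces three equal arcs, where the endpoints are permuted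
    -- cyclically.
    · refine hper j ?_
      rw [show l (j + 1) = l j by linarith, show l (j + 2) = l j by linarith]
      exact HasPeriodic.of_eq hpj (Or.inl h.symm)
    · refine hper j ?_
      rw [show l (j + 1) = l j by linarith, show l (j + 2) = l j by linarith]
      exact HasPeriodic.of_eq hpj (Or.inr (by linarith))
  have hsum := sum_subtractArc j l
  refine ⟨j, hnn, by linarith, by linarith, by linarith, fun i hi => hper j ?_⟩
  have := hi.relabel_all hnn (by linarith) (by linarith) i j
  rw [subtractArc_self, subtractArc_add_one, subtractArc_add_two] at this
  exact this.of_renorm hr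

/-- The data on which the subtraction process without periodic points runs. -/
structure AperiodicState where
  /-- the lengths of the arcs -/
  len : Fin 3 → ℝ
  /-- the rotation amount -/
  rot : ℝ
  nonneg : ∀ i, 0 ≤ len i
  sum_pos : 0 < ∑ i, len i
  rot_nonneg : 0 ≤ rot
  rot_le : rot ≤ ∑ i, len i
  aperiodic : ∀ i : Fin 3, ¬ HasPeriodic (len (i + 2)) (len i) (len (i + 1)) rot

theorem inexhaustible_of_not_hasPeriodic {l : Fin 3 → ℝ} {τ : ℝ} (hl : ∀ i, 0 ≤ l i)
    (hs : 0 < ∑ i, l i) (hτ : 0 ≤ τ) (hτs : τ ≤ ∑ i, l i)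
    (hper : ¬ HasPeriodic (l 2) (l 0) (l 1) τ) : 2 * τ = ∑ i, l i ∧ Inexhaustible l := by
  have hnext (s : AperiodicState) : ∃ (t : AperiodicState) (j : Fin 3),
      t.len = subtractArc j s.len ∧ t.rot = s.rot - s.len j := by
    obtain ⟨-, -, j, h1, h2, h3, h4, h5⟩ :=
      exists_subtractArc s.nonneg s.sum_pos s.rot_nonneg s.rot_le s.aperiodic
    exact ⟨⟨_, _, h1, h2, h3, h4, h5⟩, j, rfl, rfl⟩
  choose next j hlen hrot using hnext
  let s₀ : AperiodicState := ⟨l, τ, hl, hs, hτ, hτs, fun i hi =>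
    hper (hi.relabel_all hl hτ hτs i 0)⟩
  let S : ℕ → AperiodicState := fun n => next^[n] s₀
  have hS (n : ℕ) : S (n + 1) = next (S n) := Function.iterate_succ_apply' _ _ _
  have hstep (n : ℕ) : (S (n + 1)).len = subtractArc (j (S n)) (S n).len := by rw [hS, hlen]
  have hprop (n : ℕ) := exists_subtractArc (S n).nonneg (S n).sum_pos (S n).rot_nonneg
    (S n).rot_le (S n).aperiodic
  -- A step lowers the total by twice the arc and the rotation by the arc.
  have hinv (n : ℕ) : ∑ i, (S n).len i - 2 * (S n).rot = ∑ i, l i - 2 * τ := by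
    induction n with
    | zero => rfl
    | succ n ih =>
      rw [hstep, sum_subtractArc, hS, hrot]
      linarith
  have ht := tendsto_sum_of_subtractArc hstep (fun n i => ((hprop n).1 i).1)
    (fun n i => ((hprop n).1 i).2)
  have h1 : ∑ i, l i - 2 * τ ≤ 0 := ge_of_tendsto' ht fun n => by
    linarith [hinv n, (S n).rot_nonneg]
  have h2 : -(∑ i, l i - 2 * τ) ≤ 0 := ge_of_tendsto' ht fun n => by
    linarith [hinv n, (S n).rot_le]
  refine ⟨by linarith, fun n => (S n).len, fun n => j (S n), rfl, fun n => ⟨hstep n, fun i =>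
    ⟨((hprop n).1 i).1, (hprop n).2.1 (by linarith [hinv n]) i⟩⟩⟩

end Periodic

/-! ### A minimality criterion for piecewise reflections of the circle. -/

section Reflections

/-- Along every segment avoiding `S`, the circle map `T` is a reflection. -/
def IsLocalReflection (T : UnitAddCircle → UnitAddCircle) (S : Set UnitAddCircle) : Prop :=
  ∀ (p : UnitAddCircle) (t : ℝ), (∀ u ∈ Set.Icc (0 : ℝ) 1, p + ((u * t : ℝ) : UnitAddCircle) ∉ S) →
    T (p + (t : UnitAddCircle)) = T p - (t : UnitAddCircle)

theorem exists_lift_norm (z : UnitAddCircle) : ∃ t : ℝ, (t : UnitAddCircle) = z ∧ |t| = ‖z‖ := by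
  induction z using QuotientAddGroup.induction_on with
  | H x =>
    refine ⟨x - round x, ?_, (UnitAddCircle.norm_eq).symm⟩
    rw [AddCircle.coe_sub, sub_eq_self]
    exact (AddCircle.coe_eq_zero_iff 1).2 ⟨round x, by simp⟩

theorem eventually_add_notMem {S : Set UnitAddCircle} (hS : S.Finite) {p : UnitAddCircle}
    (hp : p ∉ S) : ∀ᶠ t : ℝ in 𝓝 0, p + (t : UnitAddCircle) ∉ S := by
  have hc : ContinuousAt (fun t : ℝ => p + (t : UnitAddCircle)) 0 :=
    (continuous_const.add (AddCircle.continuous_mk' 1)).continuousAt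
  refine hc.eventually (p := fun z => z ∉ S) (hS.isClosed.isOpen_compl.mem_nhds ?_)
  simpa using hp

theorem abs_mul_lt {u t ε : ℝ} (hu : u ∈ Set.Icc (0 : ℝ) 1) (ht : |t| < ε) : |u * t| < ε := by
  rw [abs_mul, abs_of_nonneg hu.1]
  nlinarith [hu.2, abs_nonneg t]

variable {T : UnitAddCircle → UnitAddCircle} {S : Set UnitAddCircle}

theorem IsLocalReflection.continuousAt (hT : IsLocalReflection T S) (hS : S.Finite)
    {p : UnitAddCircle} (hp : p ∉ S) : ContinuousAt T p := by
  obtain ⟨ε, hε, h⟩ := Metric.eventually_nhds_iff.1 (eventually_add_notMem hS hp)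
  have heq : T =ᶠ[𝓝 p] fun z => T p - (z - p) := by
    filter_upwards [Metric.ball_mem_nhds p hε] with z hz
    obtain ⟨t, ht, htn⟩ := exists_lift_norm (z - p)
    rw [← ht, ← hT p t fun u hu => h ?_, ht, add_sub_cancel]
    rw [Real.dist_eq, sub_zero]
    refine abs_mul_lt hu ?_
    rwa [htn, ← dist_eq_norm]
  exact ContinuousAt.congr (by fun_prop) heq.symm

/-- An injective forward orbit that avoids the singular set cannot start at an endpoint of a gap of
an invariant set. -/
theorem IsLocalReflection.no_gap (hT : IsLocalReflection T S) (hS : S.Finite)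
    {C : Set UnitAddCircle} (hC : ∀ z, z ∉ S → (z ∈ C ↔ T z ∈ C)) {x : UnitAddCircle}
    (hx : ∀ n, T^[n] x ∉ S) (hinj : Function.Injective fun n => T^[n] x) (hxC : x ∈ C) {r : ℝ}
    (hr : 0 < r) (hgap : ∀ t ∈ Set.Ioo 0 r, x + (t : UnitAddCircle) ∉ C) : False := by
  have hmem (n : ℕ) : T^[n] x ∈ C := by
    induction n with
    | zero => exact hxC
    | succ n ih =>
      rw [Function.iterate_succ_apply']
      exact (hC _ (hx n)).1 ih
  -- The gap of length `r` next to the `n`-th iterate; its side alternates since each step reverses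
  -- orientation.
  let G (n : ℕ) (r : ℝ) : Prop :=
    ∀ t ∈ Set.Ioo 0 r, T^[n] x + (((-1) ^ n * t : ℝ) : UnitAddCircle) ∉ C
  have hstep (n : ℕ) (r : ℝ) (hG : G n r)
      (hn : ∀ t ∈ Set.Ioo 0 r, T^[n] x + (((-1) ^ n * t : ℝ) : UnitAddCircle) ∉ S) :
      G (n + 1) r := by
    intro t ht hcon
    refine hG t ht ((hC _ (hn t ht)).2 ?_)
    rw [hT]
    · rw [Function.iterate_succ_apply', pow_succ] at hcon
      convert hcon using 1
      rw [mul_neg_one, neg_mul, AddCircle.coe_neg, sub_eq_add_neg]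
    · intro u hu
      rcases hu.1.eq_or_lt with rfl | hu0
      · simpa using hx n
      · rw [mul_left_comm]
        exact hn _ ⟨mul_pos hu0 ht.1, by nlinarith [ht.1, ht.2, hu.2]⟩
  have hex (n : ℕ) : ∃ r > 0, G n r := by
    induction n with
    | zero => exact ⟨r, hr, fun t ht => by simpa using hgap t ht⟩
    | succ n ih =>
      obtain ⟨r, hr, hG⟩ := ih
      obtain ⟨ε, hε, h⟩ := Metric.eventually_nhds_iff.1 (eventually_add_notMem hS (hx n))
      refine ⟨min r ε, lt_min hr hε, hstep n _ (fun t ht => hG t ⟨ht.1, ht.2.trans_le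
        (min_le_left _ _)⟩) fun t ht => h ?_⟩
      rw [Real.dist_eq, sub_zero, abs_mul, abs_pow, abs_neg, abs_one, one_pow, one_mul,
        abs_of_pos ht.1]
      exact ht.2.trans_le (min_le_right _ _)
  -- The times at which `σ` lies in the gap and may cut it. Then the iterate is the point of `C`
  -- nearest to `σ` on a given side, so injectivity leaves at most one time per side.
  let bad (σ : UnitAddCircle) : Set ℕ := {n | ∃ t > 0,
    T^[n] x + (((-1) ^ n * t : ℝ) : UnitAddCircle) = σ ∧
    ∀ u ∈ Set.Ioc 0 t, T^[n] x + (((-1) ^ n * u : ℝ) : UnitAddCircle) ∉ C}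
  have hbad (σ : UnitAddCircle) : (bad σ).Finite := by
    refine Set.Finite.of_injOn (f := fun n : ℕ => (-1 : ℝ) ^ n) (t := {1, -1})
      (fun n _ => neg_one_pow_eq_or ℝ n) ?_ (Set.toFinite _)
    rintro n ⟨t, ht, hσ, hu⟩ m ⟨t', ht', hσ', hu'⟩ (hnm : (-1 : ℝ) ^ n = (-1) ^ m)
    rw [← hnm] at hσ' hu'
    have hsub : T^[n] x = T^[m] x + (((-1) ^ n * (t' - t) : ℝ) : UnitAddCircle) := by
      rw [mul_sub, AddCircle.coe_sub, ← add_sub_assoc, hσ', ← hσ, add_sub_cancel_right]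
    rcases lt_trichotomy t t' with h | h | h
    · exact absurd (hsub ▸ hmem n) (hu' _ ⟨by linarith, by linarith⟩)
    · rw [h, sub_self, mul_zero, AddCircle.coe_zero, add_zero] at hsub
      exact hinj hsub
    · have hsub' : T^[m] x = T^[n] x + (((-1) ^ n * (t - t') : ℝ) : UnitAddCircle) := by
        rw [hsub, add_assoc, ← AddCircle.coe_add, ← mul_add]
        simp
      exact absurd (hsub' ▸ hmem m) (hu _ ⟨by linarith, by linarith⟩)
  obtain ⟨M, hM⟩ := (hS.biUnion fun σ _ => hbad σ).bddAbove
  obtain ⟨r, hr, hG⟩ := hex (M + 1)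
  have hall (n : ℕ) (hn : M + 1 ≤ n) : G n r := by
    induction n, hn using Nat.le_induction with
    | base => exact hG
    | succ n hn ih =>
      refine hstep n r ih fun t ht hcon => ?_
      have : n ∈ ⋃ σ ∈ S, bad σ := Set.mem_biUnion hcon
        ⟨t, ht.1, rfl, fun u hu => ih u ⟨hu.1, hu.2.trans_lt ht.2⟩⟩
      have := hM this
      omega
  -- Even times put all gaps on the same side. Two distinct iterates closer than `r` then place one
  -- in the gap of the other.
  obtain ⟨a, φ, hφ, ha⟩ := CompactSpace.tendsto_subseq fun n => T^[2 * (M + 1 + n)] x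
  obtain ⟨K, hK⟩ := Metric.cauchySeq_iff.1 ha.cauchySeq r hr
  have hd := hK (K + 1) (by omega) K le_rfl
  have hne : φ (K + 1) ≠ φ K := hφ.injective.ne (by omega)
  simp only [Function.comp_apply] at hd
  set m := 2 * (M + 1 + φ (K + 1)) with hm
  set n := 2 * (M + 1 + φ K) with hn
  obtain ⟨t, ht, htn⟩ := exists_lift_norm (T^[m] x - T^[n] x)
  rw [← dist_eq_norm] at htn
  rw [← htn] at hd
  have hpm : (-1 : ℝ) ^ m = 1 := (even_two_mul _).neg_one_pow
  have hpn : (-1 : ℝ) ^ n = 1 := (even_two_mul _).neg_one_pow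
  have ht0 : t ≠ 0 := by
    rintro rfl
    rw [AddCircle.coe_zero, eq_comm, sub_eq_zero] at ht
    have := hinj ht
    omega
  rcases ht0.lt_or_gt with h | h
  · refine hall m (by omega) (-t) ⟨by linarith, by rwa [← abs_of_neg h]⟩ ?_
    rw [hpm, one_mul, AddCircle.coe_neg, ht]
    simpa using hmem n
  · refine hall n (by omega) t ⟨h, by rwa [← abs_of_pos h]⟩ ?_
    rw [hpn, one_mul, ht]
    simpa using hmem m

/-- A periodic orbit meeting `S` would give a connection. One avoiding `S` has a whole neighbourhood
whose iterates stay near the orbit and never meet `S`, against `hreg`. -/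
theorem IsLocalReflection.notMem_periodicPts (hT : IsLocalReflection T S) (hS : S.Finite)
    (hconn : ∀ σ ∈ S, ∀ n, T^[n + 1] σ ∉ S)
    (hreg : ∀ (x : UnitAddCircle) (r : ℝ), 0 < r →
      ∃ t ∈ Set.Ioo 0 r, ∃ n, T^[n] (x + (t : UnitAddCircle)) ∈ S) (x : UnitAddCircle) :
    x ∉ Function.periodicPts T := by
  rintro ⟨n, hn, hp⟩
  have hx (k : ℕ) : T^[k] x ∉ S := by
    intro hk
    obtain ⟨m, rfl⟩ := Nat.exists_eq_succ_of_ne_zero hn.ne'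
    refine hconn _ hk m ?_
    rwa [← Nat.succ_eq_add_one, ← Function.iterate_add_apply, add_comm,
      Function.iterate_add_apply, hp]
  have hev : ∀ᶠ t : ℝ in 𝓝 0, ∀ k ∈ Finset.range n, T^[k] x + (t : UnitAddCircle) ∉ S :=
    (eventually_all_finset _).2 fun k _ => eventually_add_notMem hS (hx k)
  obtain ⟨ε, hε, h⟩ := Metric.eventually_nhds_iff.1 hev
  have hall (k : ℕ) (t : ℝ) (ht : |t| < ε) : T^[k] x + (t : UnitAddCircle) ∉ S := by
    rw [← hp.iterate_mod_apply k]
    exact h (by rwa [Real.dist_eq, sub_zero]) _ (Finset.mem_range.2 (Nat.mod_lt _ hn))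
  have habs (k : ℕ) (t : ℝ) : |(-1) ^ k * t| = |t| := by simp [abs_mul]
  have hit (t : ℝ) (ht : |t| < ε) (k : ℕ) :
      T^[k] (x + (t : UnitAddCircle)) = T^[k] x + (((-1) ^ k * t : ℝ) : UnitAddCircle) := by
    induction k with
    | zero => simp
    | succ k ih =>
      rw [Function.iterate_succ_apply', ih, hT, Function.iterate_succ_apply', pow_succ,
        mul_neg_one, neg_mul, AddCircle.coe_neg, sub_eq_add_neg]
      intro u hu
      exact hall k _ (abs_mul_lt hu (by rwa [habs]))
  obtain ⟨t, ht, k, hk⟩ := hreg x ε hε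
  have ht' : |t| < ε := by rw [abs_of_pos ht.1]; exact ht.2
  rw [hit t ht'] at hk
  exact hall k _ (by rwa [habs]) hk

theorem iterate_injective_of_notMem_periodicPts {α : Type*} {f : α → α}
    (hf : Function.Injective f) {x : α} (hx : x ∉ Function.periodicPts f) :
    Function.Injective fun n => f^[n] x := by
  have key (m n : ℕ) (h : f^[m] x = f^[n] x) : n ≤ m := by
    by_contra! hlt
    refine hx ⟨n - m, by omega, hf.iterate m ?_⟩
    rw [← Function.iterate_add_apply, Nat.add_sub_cancel' hlt.le, h]
  exact fun m n h => le_antisymm (key n m h.symm) (key m n h)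

theorem exists_gap {C : Set UnitAddCircle} (hC : IsClosed C) (hne : C.Nonempty)
    (huniv : C ≠ Set.univ) :
    ∃ x ∈ C, ∃ r > 0, ∀ t ∈ Set.Ioo (0 : ℝ) r, x + (t : UnitAddCircle) ∉ C := by
  obtain ⟨c, hc⟩ := hne
  obtain ⟨z, hz⟩ := (Set.ne_univ_iff_exists_notMem _).1 huniv
  -- Going backwards from a point outside `C`, the first point of `C` met bounds a gap.
  let A : Set ℝ := {t | 0 ≤ t ∧ z - (t : UnitAddCircle) ∈ C}
  have hA : IsClosed A := isClosed_Ici.inter <| hC.preimage <|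
    continuous_const.sub (AddCircle.continuous_mk' 1)
  have hA0 : BddBelow A := ⟨0, fun t ht => ht.1⟩
  have hAne : A.Nonempty := by
    obtain ⟨t, ht, hzt⟩ := (AddCircle.eq_coe_Ico (z - c))
    exact ⟨t, ht.1, by rw [hzt]; simpa using hc⟩
  have hmem : sInf A ∈ A := hA.csInf_mem hAne hA0
  refine ⟨_, hmem.2, sInf A, hmem.1.lt_of_ne fun h0 => hz ?_, fun t ht hcon => ?_⟩
  · have := hmem.2
    rw [← h0] at this
    simpa using this
  · have : sInf A - t ∈ A := ⟨by linarith [ht.2], by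
      rw [AddCircle.coe_sub, sub_sub_eq_add_sub, add_sub_right_comm]; exact hcon⟩
    linarith [csInf_le hA0 this, ht.1]

/-- A bijective piecewise reflection of the circle without connections and without intervals of
regular orbits is minimal. -/
theorem IsLocalReflection.isMinimalMap {R : UnitAddCircle → UnitAddCircle}
    (hRT : Function.LeftInverse R T) (hTR : Function.RightInverse R T) (hS : S.Finite)
    (hT : IsLocalReflection T S) (hR : IsLocalReflection R (T '' S))
    (hconn : ∀ σ ∈ S, ∀ n, T^[n + 1] σ ∉ S)
    (hreg : ∀ (x : UnitAddCircle) (r : ℝ), 0 < r →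
      ∃ t ∈ Set.Ioo 0 r, ∃ n, T^[n] (x + (t : UnitAddCircle)) ∈ S) : IsMinimalMap T := by
  intro p
  have hper := hT.notMem_periodicPts hS hconn hreg
  -- The limit set of the orbit is closed, nonempty and, off the singular sets, invariant under `T`
  -- and `R`.
  let C : Set UnitAddCircle := {z | MapClusterPt z atTop fun n => T^[n] p}
  have hCcl : IsClosed C := isClosed_setOfPred_clusterPt
  have hCne : C.Nonempty := exists_clusterPt_of_compactSpace _
  have hshift (z : UnitAddCircle) :
      z ∈ C ↔ MapClusterPt z atTop fun n => T^[n + 1] p := by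
    change ClusterPt z (map _ atTop) ↔ ClusterPt z (map ((fun n => T^[n] p) ∘ (· + 1)) atTop)
    rw [← Filter.map_map, map_add_atTop_eq_nat]
  have hfwd (z : UnitAddCircle) (hz : z ∉ S) (h : z ∈ C) : T z ∈ C := by
    rw [hshift]
    refine (MapClusterPt.continuousAt_comp (hT.continuousAt hS hz) h).congrFun ?_
    exact Eventually.of_forall fun n => (Function.iterate_succ_apply' _ _ _).symm
  have hbwd (z : UnitAddCircle) (hz : z ∉ T '' S) (h : z ∈ C) : R z ∈ C := by
    rw [hshift] at h
    refine (MapClusterPt.continuousAt_comp (hR.continuousAt (hS.image T) hz) h).congrFun ?_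
    exact Eventually.of_forall fun n => by
      simp only [Function.comp_apply, Function.iterate_succ_apply']
      exact hRT _
  have hTi : Function.Injective T := hRT.injective
  have hT_mem (z : UnitAddCircle) (hz : z ∉ S) : z ∈ C ↔ T z ∈ C := by
    refine ⟨hfwd z hz, fun h => ?_⟩
    have := hbwd (T z) (fun h => hz ((hTi.mem_set_image).1 h)) h
    rwa [hRT] at this
  have hR_mem (z : UnitAddCircle) (hz : z ∉ T '' S) : z ∈ C ↔ R z ∈ C := by
    refine ⟨hbwd z hz, fun h => ?_⟩
    have := hfwd (R z) (fun h => hz ⟨_, h, hTR z⟩) h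
    rwa [hTR] at this
  have hCuniv : C = Set.univ := by
    by_contra hne
    obtain ⟨x, hx, r, hr, hgap⟩ := exists_gap hCcl hCne hne
    by_cases hf : ∀ n, T^[n] x ∉ S
    · exact hT.no_gap hS hT_mem hf (iterate_injective_of_notMem_periodicPts hTi (hper x)) hx hr
        hgap
    push Not at hf
    obtain ⟨n, hn⟩ := hf
    have hperR : x ∉ Function.periodicPts R := by
      rintro ⟨k, hk, hkx⟩
      refine hper x ⟨k, hk, ?_⟩
      have := (hTR.iterate k) x
      rwa [hkx] at this
    -- The forward orbit of `x` meets `S`. If the backward orbit met `T '' S`, the two meetings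
    -- would form a connection.
    refine hR.no_gap (hS.image T) hR_mem (fun m hm => ?_)
      (iterate_injective_of_notMem_periodicPts hTR.injective hperR) hx hr hgap
    obtain ⟨σ, hσ, hσx⟩ := hm
    refine hconn σ hσ (n + m) ?_
    rw [Function.iterate_succ_apply, hσx, Function.iterate_add_apply, (hTR.iterate m) x]
    exact hn
  intro z
  have hz : z ∈ C := hCuniv ▸ Set.mem_univ z
  have hz' : ClusterPt z (map (fun n => T^[n] p) atTop) := hz
  exact mem_closure_iff_clusterPt.2 (hz'.mono (le_principal_iff.2 range_mem_map))

end Reflections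

/-! ### Transfer between the circle map and the interval model. -/

section Circle

theorem arcFlip_of_mem {u v x : ℝ} (hx : x ∈ Set.Ioo u v) :
    arcFlip u v (x : UnitAddCircle) = ((u + v - x : ℝ) : UnitAddCircle) := by
  rw [arcFlip, if_pos ⟨x, hx, rfl⟩, ← AddCircle.coe_sub]

theorem arcFlip_of_notMem {u v x : ℝ} (hu : 0 ≤ u) (hv : v ≤ 1) (hx : x ∈ Set.Ico (0 : ℝ) 1)
    (hxu : x ∉ Set.Ioo u v) : arcFlip u v (x : UnitAddCircle) = x := by
  rw [arcFlip, if_neg]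
  rintro ⟨t, ht, htx⟩
  refine hxu ?_
  rwa [← (AddCircle.coe_eq_coe_iff_of_mem_Ico (p := 1) (a := 0)
    ⟨hu.trans ht.1.le, by simpa using ht.2.trans_le hv⟩ (by simpa using hx)).1 htx]

variable {l : Fin 3 → ℝ}

theorem cetInvolution_first (hl : ∀ i, 0 ≤ l i) (hs : l 0 + l 1 + l 2 = 1) {x : ℝ}
    (hx : x ∈ Set.Ioo 0 (l 0)) :
    cetInvolution l (x : UnitAddCircle) = ((0 + l 0 - x : ℝ) : UnitAddCircle) := by
  have h0 := hl 0
  have h1 := hl 1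
  have h2 := hl 2
  obtain ⟨hx₁, hx₂⟩ := hx
  rw [cetInvolution, Function.comp_apply, Function.comp_apply, arcFlip_of_mem ⟨hx₁, hx₂⟩,
    arcFlip_of_notMem (by linarith) (by linarith) ⟨by linarith, by linarith⟩
      fun h => by linarith [h.1],
    arcFlip_of_notMem (by linarith) (by linarith) ⟨by linarith, by linarith⟩
      fun h => by linarith [h.1]]

theorem cetInvolution_second (hl : ∀ i, 0 ≤ l i) (hs : l 0 + l 1 + l 2 = 1) {x : ℝ}
    (hx : x ∈ Set.Ioo (l 0) (l 0 + l 1)) :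
    cetInvolution l (x : UnitAddCircle) = ((l 0 + (l 0 + l 1) - x : ℝ) : UnitAddCircle) := by
  have h0 := hl 0
  have h1 := hl 1
  have h2 := hl 2
  obtain ⟨hx₁, hx₂⟩ := hx
  rw [cetInvolution, Function.comp_apply, Function.comp_apply,
    arcFlip_of_notMem (by linarith) (by linarith) ⟨by linarith, by linarith⟩
      fun h => by linarith [h.2], arcFlip_of_mem ⟨hx₁, hx₂⟩,
    arcFlip_of_notMem (by linarith) (by linarith) ⟨by linarith, by linarith⟩
      fun h => by linarith [h.1]]

theorem cetInvolution_third (hl : ∀ i, 0 ≤ l i) (hs : l 0 + l 1 + l 2 = 1) {x : ℝ}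
    (hx : x ∈ Set.Ioo (l 0 + l 1) 1) :
    cetInvolution l (x : UnitAddCircle) = ((l 0 + l 1 + 1 - x : ℝ) : UnitAddCircle) := by
  have h0 := hl 0
  have h1 := hl 1
  have h2 := hl 2
  obtain ⟨hx₁, hx₂⟩ := hx
  rw [cetInvolution, Function.comp_apply, Function.comp_apply,
    arcFlip_of_notMem (by linarith) (by linarith) ⟨by linarith, by linarith⟩
      fun h => by linarith [h.2],
    arcFlip_of_notMem (by linarith) (by linarith) ⟨by linarith, by linarith⟩
      fun h => by linarith [h.2], hs, arcFlip_of_mem ⟨hx₁, hx₂⟩]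

theorem cetInvolution_fixed (hl : ∀ i, 0 ≤ l i) (hs : l 0 + l 1 + l 2 = 1) {x : ℝ}
    (hx : x ∈ Set.Ico (0 : ℝ) 1) (h : x = 0 ∨ x = l 0 ∨ x = l 0 + l 1) :
    cetInvolution l (x : UnitAddCircle) = x := by
  have h0 := hl 0
  have h1 := hl 1
  have h2 := hl 2
  rw [cetInvolution, Function.comp_apply, Function.comp_apply,
    arcFlip_of_notMem le_rfl (by linarith) hx ?_,
    arcFlip_of_notMem (by linarith) (by linarith) hx ?_,
    arcFlip_of_notMem (by linarith) (by linarith) hx ?_] <;>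
  · rintro ⟨h₁, h₂⟩
    rcases h with h | h | h <;> linarith

/-- The common endpoints of the three arcs. -/
def cetBreaks (l : Fin 3 → ℝ) : Set UnitAddCircle :=
  {((0 : ℝ) : UnitAddCircle), ((l 0 : ℝ) : UnitAddCircle), ((l 0 + l 1 : ℝ) : UnitAddCircle)}

theorem coe_one_eq_zero : ((1 : ℝ) : UnitAddCircle) = ((0 : ℝ) : UnitAddCircle) :=
  AddCircle.coe_period 1

/-- Every point outside the endpoints lies in one of the three arcs. -/
theorem exists_arc (hl : ∀ i, 0 ≤ l i) (hs : l 0 + l 1 + l 2 = 1) {p : UnitAddCircle}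
    (hp : p ∉ cetBreaks l) : ∃ u v x : ℝ, (x : UnitAddCircle) = p ∧ x ∈ Set.Ioo u v ∧
      (u : UnitAddCircle) ∈ cetBreaks l ∧ (v : UnitAddCircle) ∈ cetBreaks l ∧
      ∀ y ∈ Set.Ioo u v,
        cetInvolution l (y : UnitAddCircle) = ((u + v - y : ℝ) : UnitAddCircle) := by
  obtain ⟨x, hx, rfl⟩ := AddCircle.eq_coe_Ico p
  have h0 : x ≠ 0 := fun h => hp (by simp [cetBreaks, h])
  have h1 : x ≠ l 0 := fun h => hp (by simp [cetBreaks, h])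
  have h2 : x ≠ l 0 + l 1 := fun h => hp (by simp [cetBreaks, h])
  rcases h1.lt_or_gt with h | h
  · exact ⟨0, l 0, x, rfl, ⟨hx.1.lt_of_ne h0.symm, h⟩, by simp [cetBreaks], by simp [cetBreaks],
      fun y hy => cetInvolution_first hl hs hy⟩
  rcases h2.lt_or_gt with h' | h'
  · exact ⟨_, _, x, rfl, ⟨h, h'⟩, by simp [cetBreaks], by simp [cetBreaks],
      fun y hy => cetInvolution_second hl hs hy⟩
  · exact ⟨_, 1, x, rfl, ⟨h', hx.2⟩, by simp [cetBreaks], by rw [coe_one_eq_zero]; simp [cetBreaks],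
      fun y hy => cetInvolution_third hl hs hy⟩

theorem cetInvolution_of_mem_breaks (hl : ∀ i, 0 ≤ l i) (hs : l 0 + l 1 + l 2 = 1)
    {p : UnitAddCircle} (hp : p ∈ cetBreaks l) : cetInvolution l p = p := by
  have h0 := hl 0
  have h1 := hl 1
  have h2 := hl 2
  have key (x : ℝ) (hx : 0 ≤ x) (hx1 : x ≤ 1) (h : x = 0 ∨ x = l 0 ∨ x = l 0 + l 1) :
      cetInvolution l (x : UnitAddCircle) = x := by
    rcases hx1.eq_or_lt with h' | h'
    · rw [h', coe_one_eq_zero]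
      exact cetInvolution_fixed hl hs ⟨le_rfl, one_pos⟩ (Or.inl rfl)
    · exact cetInvolution_fixed hl hs ⟨hx, h'⟩ h
  rcases hp with rfl | rfl | rfl
  · exact key 0 le_rfl zero_le_one (by simp)
  · exact key _ (by linarith) (by linarith) (by simp)
  · exact key _ (by linarith) (by linarith) (by simp)

theorem cetInvolution_involutive (hl : ∀ i, 0 ≤ l i) (hs : l 0 + l 1 + l 2 = 1) :
    Function.Involutive (cetInvolution l) := by
  intro p
  by_cases hp : p ∈ cetBreaks l
  · rw [cetInvolution_of_mem_breaks hl hs hp, cetInvolution_of_mem_breaks hl hs hp]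
  · obtain ⟨u, v, x, rfl, hx, -, -, h⟩ := exists_arc hl hs hp
    rw [h x hx, h _ ⟨by linarith [hx.2], by linarith [hx.1]⟩, sub_sub_cancel]

theorem isLocalReflection_cetInvolution (hl : ∀ i, 0 ≤ l i) (hs : l 0 + l 1 + l 2 = 1) :
    IsLocalReflection (cetInvolution l) (cetBreaks l) := by
  intro p t ht
  obtain ⟨u, v, x, rfl, hx, hu, hv, h⟩ := exists_arc hl hs (p := p) (by simpa using ht 0 (by simp))
  have hcross (e : ℝ) (he : (e : UnitAddCircle) ∈ cetBreaks l) (k : ℝ)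
      (hk : k ∈ Set.Icc (0 : ℝ) 1) : x + k * t ≠ e := by
    rintro rfl
    exact ht k hk (by rwa [← AddCircle.coe_add])
  have hxt : x + t ∈ Set.Ioo u v := by
    constructor
    · by_contra! hcon
      have htn : t < 0 := by linarith [hx.1]
      refine hcross u hu ((u - x) / t) ⟨div_nonneg_of_nonpos (by linarith [hx.1]) htn.le, ?_⟩ ?_
      · rw [div_le_one_of_neg htn]
        linarith
      · rw [div_mul_cancel₀ _ htn.ne]
        ring
    · by_contra! hcon
      have htp : 0 < t := by linarith [hx.2]
      refine hcross v hv ((v - x) / t) ⟨div_nonneg (by linarith [hx.2]) htp.le, ?_⟩ ?_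
      · rw [div_le_one htp]
        linarith
      · rw [div_mul_cancel₀ _ htp.ne']
        ring
  rw [← AddCircle.coe_add, h _ hxt, h _ hx, ← AddCircle.coe_sub]
  congr 1
  ring

theorem isLocalReflection_cetMap (hl : ∀ i, 0 ≤ l i) (hs : l 0 + l 1 + l 2 = 1)
    (τ : UnitAddCircle) : IsLocalReflection (cetMap l τ) (cetBreaks l) := by
  intro p t ht
  rw [cetMap, cetMap, isLocalReflection_cetInvolution hl hs p t ht]
  abel

/-- The inverse is needed as well, since a gap end may have a regular orbit only in backward time.
-/
theorem isLocalReflection_cetMap_inverse (hl : ∀ i, 0 ≤ l i) (hs : l 0 + l 1 + l 2 = 1)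
    (τ : UnitAddCircle) :
    IsLocalReflection (fun q => cetInvolution l (q - τ)) (cetMap l τ '' cetBreaks l) := by
  intro q t ht
  simp only
  rw [add_sub_right_comm]
  refine isLocalReflection_cetInvolution hl hs _ t fun u hu hcon => ht u hu ⟨_, hcon, ?_⟩
  rw [cetMap, cetInvolution_of_mem_breaks hl hs hcon]
  abel

theorem coe_flipMap (hl : ∀ i, 0 ≤ l i) (hs : l 0 + l 1 + l 2 = 1) (t : ℝ) {x : ℝ}
    (hx : x ∈ Set.Ico (-l 2) (l 0 + l 1)) :
    ((flipMap (l 2) (l 0) (l 1) t x : ℝ) : UnitAddCircle) = cetMap l t x := by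
  have h0 := hl 0
  have h1 := hl 1
  have h2 := hl 2
  have hone : ((l 2 + l 0 + l 1 : ℝ) : UnitAddCircle) = 0 := by
    rw [show l 2 + l 0 + l 1 = 1 by linarith, coe_one_eq_zero, AddCircle.coe_zero]
  rw [cetMap]
  have key (y : ℝ) (hy : cetInvolution l (x : UnitAddCircle) = (y : UnitAddCircle)) :
      ((if y + t < l 0 + l 1 then y + t else y + t - (l 2 + l 0 + l 1) : ℝ) : UnitAddCircle) =
        cetInvolution l x + t := by
    rw [hy]
    split_ifs
    · rw [AddCircle.coe_add]
    · rw [AddCircle.coe_sub, hone, sub_zero, AddCircle.coe_add]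
  rw [flipMap]
  refine key _ ?_
  have hneg : (x : UnitAddCircle) = ((x + 1 : ℝ) : UnitAddCircle) := by
    rw [AddCircle.coe_add, coe_one_eq_zero, AddCircle.coe_zero, add_zero]
  split_ifs with h h' h''
  · refine cetInvolution_of_mem_breaks hl hs ?_
    rcases h with h | h | h
    · rw [hneg, h, show -l 2 + 1 = l 0 + l 1 by linarith]
      simp [cetBreaks]
    · simp [cetBreaks, h]
    · simp [cetBreaks, h]
  · push Not at h
    have hlt := hx.1.lt_of_ne h.1.symm
    rw [hneg, cetInvolution_third hl hs ⟨by linarith, by linarith⟩,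
      show l 0 + l 1 + 1 - (x + 1) = -l 2 - x + 1 by linarith, AddCircle.coe_add,
      coe_one_eq_zero, AddCircle.coe_zero, add_zero]
  · push Not at h h'
    rw [cetInvolution_first hl hs ⟨h'.lt_of_ne h.2.1.symm, h''⟩, zero_add]
  · push Not at h h' h''
    rw [cetInvolution_second hl hs ⟨h''.lt_of_ne h.2.2.symm, hx.2⟩]
    congr 1
    ring

theorem coe_flipMap_iterate (hl : ∀ i, 0 ≤ l i) (hs : l 0 + l 1 + l 2 = 1) {t : ℝ} (ht : 0 ≤ t)
    (ht1 : t ≤ 1) {x : ℝ} (hx : x ∈ Set.Ico (-l 2) (l 0 + l 1)) (n : ℕ) :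
    (((flipMap (l 2) (l 0) (l 1) t)^[n] x : ℝ) : UnitAddCircle) = (cetMap l t)^[n] x := by
  induction n with
  | zero => rfl
  | succ n ih =>
    rw [Function.iterate_succ_apply', Function.iterate_succ_apply', ← ih, coe_flipMap hl hs]
    exact iterate_mem (fun _ h => flipMap_mem (hl _) (hl _) (hl _) ht (by linarith) h) hx n

theorem exists_coe_eq (hs : l 0 + l 1 + l 2 = 1) (p : UnitAddCircle) :
    ∃ x ∈ Set.Ico (-l 2) (l 0 + l 1), (x : UnitAddCircle) = p := by
  obtain ⟨x, hx, h⟩ := AddCircle.coe_image_Ico_eq (1 : ℝ) (-l 2) ▸ Set.mem_univ p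
  exact ⟨x, ⟨hx.1, by linarith [hx.2]⟩, h⟩

theorem coe_mem_cetBreaks (hl : ∀ i, 0 ≤ l i) (hl1 : 0 < l 1) (hs : l 0 + l 1 + l 2 = 1) {x : ℝ}
    (hx : x ∈ Set.Ico (-l 2) (l 0 + l 1)) :
    (x : UnitAddCircle) ∈ cetBreaks l ↔ x ∈ breaks (l 2) (l 0) := by
  have h0 := hl 0
  have h2 := hl 2
  have hinj (y : ℝ) (hy : y ∈ Set.Ico (-l 2) (l 0 + l 1)) :
      (x : UnitAddCircle) = (y : UnitAddCircle) ↔ x = y :=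
    AddCircle.coe_eq_coe_iff_of_mem_Ico (a := -l 2) ⟨hx.1, by linarith [hx.2]⟩
      ⟨hy.1, by linarith [hy.2]⟩
  have hv : ((l 0 + l 1 : ℝ) : UnitAddCircle) = ((-l 2 : ℝ) : UnitAddCircle) := by
    rw [show l 0 + l 1 = -l 2 + 1 by linarith, AddCircle.coe_add, coe_one_eq_zero,
      AddCircle.coe_zero, add_zero]
  rw [cetBreaks, hv, mem_breaks]
  simp only [Set.mem_insert_iff, Set.mem_singleton_iff]
  rw [hinj 0 ⟨by linarith, by linarith⟩, hinj (l 0) ⟨by linarith, by linarith⟩,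
    hinj (-l 2) ⟨le_rfl, by linarith⟩]
  tauto

theorem isMinimalMap_cetMap_of_inexhaustible (h : Inexhaustible l) (hs : l 0 + l 1 + l 2 = 1) :
    IsMinimalMap (cetMap l ((1 / 2 : ℝ) : UnitAddCircle)) := by
  have hl (i : Fin 3) : 0 ≤ l i := (h.pos i).le
  have hsum : (∑ k, l k) / 2 = 1 / 2 := by rw [Fin.sum_univ_three, hs]
  have hbr {x : ℝ} (hx : x ∈ Set.Ico (-l 2) (l 0 + l 1)) (n : ℕ) :
      (cetMap l ((1 / 2 : ℝ) : UnitAddCircle))^[n] x ∈ cetBreaks l ↔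
        (flipMap (l 2) (l 0) (l 1) (1 / 2))^[n] x ∈ breaks (l 2) (l 0) := by
    rw [← coe_flipMap_iterate hl hs (by norm_num) (by norm_num) hx, coe_mem_cetBreaks hl (h.pos 1) hs
      (iterate_mem (fun _ h => flipMap_mem (hl _) (hl _) (hl _) (by norm_num) (by linarith) h) hx n)]
  refine IsLocalReflection.isMinimalMap (S := cetBreaks l)
    (R := fun q => cetInvolution l (q - ((1 / 2 : ℝ) : UnitAddCircle))) (fun p => ?_) (fun p => ?_)
    (by rw [cetBreaks]; exact Set.toFinite _) (isLocalReflection_cetMap hl hs _) (isLocalReflection_cetMap_inverse hl hs _)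
    (fun σ hσ n hcon => ?_) (fun p r hr => ?_)
  · simp only [cetMap, add_sub_cancel_right]
    exact cetInvolution_involutive hl hs p
  · simp only [cetMap]
    rw [cetInvolution_involutive hl hs, sub_add_cancel]
  · obtain ⟨x, hx, rfl⟩ := exists_coe_eq hs σ
    refine not_hasConnection n l h 0 ?_
    rw [hsum]
    exact ⟨x, (coe_mem_cetBreaks hl (h.pos 1) hs hx).1 hσ, (hbr hx _).1 hcon⟩
  · obtain ⟨x, hx, rfl⟩ := exists_coe_eq hs p
    by_contra! hcon
    -- The width is capped so that the interval does not run past the end of the fundamental domain.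
    refine not_hasRegularInterval h 0 (w := min r (l 0 + l 1 - x))
      (lt_min hr (by linarith [hx.2])) ?_
    rw [hsum]
    refine ⟨x, fun y hy => ?_⟩
    have hy1 := hy.1
    have hyr : y < x + r := by linarith [hy.2, min_le_left r (l 0 + l 1 - x)]
    have hyD : y ∈ Set.Ico (-l 2) (l 0 + l 1) :=
      ⟨by linarith [hx.1], by linarith [hy.2, min_le_right r (l 0 + l 1 - x)]⟩
    refine ⟨hyD, fun n hn => hcon (y - x) ⟨by linarith, by linarith⟩ n ?_⟩
    rw [← AddCircle.coe_add, add_sub_cancel]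
    exact (hbr hyD n).2 hn

/-- A periodic orbit is finite, hence closed, and cannot be dense in the infinite circle. -/
theorem IsMinimalMap.notMem_periodicPts {F : UnitAddCircle → UnitAddCircle} (hF : IsMinimalMap F)
    (p : UnitAddCircle) : p ∉ Function.periodicPts F := by
  rintro ⟨n, hn, hp⟩
  have hfin : (Set.range fun k => F^[k] p).Finite := by
    refine ((Set.finite_lt_nat n).image fun k => F^[k] p).subset ?_
    rintro _ ⟨k, rfl⟩
    exact ⟨k % n, Nat.mod_lt _ hn, hp.iterate_mod_apply k⟩
  have huniv := (hF p).closure_eq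
  rw [hfin.isClosed.closure_eq] at huniv
  rw [huniv, ← AddCircle.coe_image_Ico_eq (1 : ℝ) 0] at hfin
  refine Set.Ico_infinite (show (0 : ℝ) < 0 + 1 by norm_num) (hfin.of_finite_image ?_)
  exact fun x hx y hy h => (AddCircle.coe_eq_coe_iff_of_mem_Ico hx hy).1 h

end Circle

theorem mainTheorem7 (l : Fin 3 → ℝ) (hl : l ∈ stdSimplex ℝ (Fin 3)) (τ : UnitAddCircle) :
    IsMinimalMap (cetMap l τ) ↔
      τ = ((1 / 2 : ℝ) : UnitAddCircle) ∧ (fun j => 1 - 2 * l j) ∈ rauzyGasket := by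
  obtain ⟨hnn, hsum⟩ := hl
  have hs : l 0 + l 1 + l 2 = 1 := by rw [← Fin.sum_univ_three, hsum]
  rw [← inexhaustible_iff hsum]
  constructor
  · intro hmin
    obtain ⟨t, ht, rfl⟩ := AddCircle.eq_coe_Ico τ
    obtain ⟨h1, h2⟩ := inexhaustible_of_not_hasPeriodic hnn (by rw [hsum]; exact one_pos) ht.1
      (by rw [hsum]; exact ht.2.le) (by
        rintro ⟨x, hx, n, hn, hp⟩
        refine hmin.notMem_periodicPts x ⟨n, hn, ?_⟩
        rw [Function.IsPeriodicPt, Function.IsFixedPt,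
          ← coe_flipMap_iterate hnn hs ht.1 ht.2.le hx, hp])
    refine ⟨?_, h2⟩
    rw [show t = 1 / 2 by linarith]
  · rintro ⟨rfl, h⟩
    exact isMinimalMap_cetMap_of_inexhaustible h hs
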